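/- Let $d\ge 2$ and let $\Omega_1,\Omega_2\subset\mathbb R^d$ be bounded, connected, non-empty open sets with Lipschitz boundary (near each boundary point, in suitable Cartesian coordinates, the set is the region on one side of the graph of a Lipschitz function). Suppose in addition that $\Omega_1$ is of class $C^1$ (the graph functions can be chosen $C^1$). All functions are complex-valued; $C(\overline\Omega)$ carries the supremum norm, $\sigma$ denotes surface measure on $\partial\Omega$, and $C_c^\infty(\Omega)$ is the space of smooth functions with compact support in $\Omega$. For $u\in H^1(\Omega)$ with distributional Laplacian $\Delta u\in L^2(\Omega)$, a function $h\in L^2(\partial\Omega)$ is called the normal derivative $\frac{\partial u}{\partial\nu}$ of $u$ if $$\int_\Omega \nabla u\cdot\overline{\nabla v}+\Delta u\,\overline v\,dx=\int_{\partial\Omega}h\,\overline v\,d\sigma\qquad\text{for all } v\in H^1(\Omega),$$ where on the right $v$ is understood as its trace. For $\beta\in C(\partial\Omega)$ the Robin Laplacian $\Delta^\beta_\Omega$ on $C(\overline\Omega)$ has the domain $$D(\Delta_\Omega^\beta)=\Big\{u\in H^1(\Omega)\cap C(\overline\Omega):\ \Delta u\in L^2(\Omega)\cap C(\overline\Omega),\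 \tfrac{\partial u}{\partial \nu}\in L^2(\partial\Omega) \text{ exists and equals } -\beta u\Big\},\qquad \Delta^\beta_\Omega u=\Delta u$$ (the case $\beta=0$ is the Neumann Laplacian). Let $U:C(\overline\Omega_1)\to C(\overline\Omega_2)$ be a bounded linear operator such that (a) if $f,g\in C(\overline\Omega_1)$ and $f\cdot g=0$, then $(Uf)\cdot(Ug)=0$; (b) for some $\beta\in C(\partial\Omega_2)$ one has $U(C_c^\infty(\Omega_1))\subset D(\Delta^\beta_{\Omega_2})$, and $U(\Delta f)=\Delta(Uf)$ for all $f\in C_c^\infty(\Omega_1)$; (c) if $\omega\subset\Omega_2$ is open and $(Uf)|_\omega=0$ for all $f\in C_c^\infty(\Omega_1)$, then $\omega=\emptyset$. Then there exist an isometry $\tau:\mathbb R^d\to\mathbb R^d$ with $\tau(\Omega_2)=\Omega_1$ and a constant $c\in\mathbb C\setminus\{0\}$ such that $$Uf(y)=c\,f(\tau(y))\qquad\text{for all } f\in C(\overline\Omega_1)\text{ and all } y\in\overline\Omega_2.$$ In particular, $\Omega_1$ and $\Omega_2$ are congruent. -/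

import Mathlib

open MeasureTheory Filter Topology Set InnerProductSpace
open scoped ContDiff ENNReal NNReal ComplexConjugate

noncomputable section

namespace RobinIntertwining

/-- Euclidean space `ℝ^d`. -/
abbrev Eucl (d : ℕ) : Type := EuclideanSpace ℝ (Fin d)

variable {d : ℕ}

/-! ### Regularity of domains -/

/-- The component of `x` orthogonal to the unit vector `e`. -/
def perp (e x : Eucl d) : Eucl d := x - (inner ℝ e x) • e

/-- `Ω` is, near each boundary point and in suitable Cartesian coordinates (with "vertical" unit
vector `e`), the set of points strictly above the graph of a Lipschitz function of the remaining
coordinates. -/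
def HasLipschitzBoundary (Ω : Set (Eucl d)) : Prop :=
  ∀ z ∈ frontier Ω, ∃ (e : Eucl d) (γ : Eucl d → ℝ) (K : ℝ≥0) (V : Set (Eucl d)),
    ‖e‖ = 1 ∧ LipschitzWith K γ ∧ IsOpen V ∧ z ∈ V ∧
      ∀ x ∈ V, (x ∈ Ω ↔ γ (perp e x) < inner ℝ e x)

/-- `Ω` is, near each boundary point and in suitable Cartesian coordinates, the set of points
strictly above the graph of a `C^1` function of the remaining coordinates. -/
def HasC1Boundary (Ω : Set (Eucl d)) : Prop :=
  ∀ z ∈ frontier Ω, ∃ (e : Eucl d) (γ : Eucl d → ℝ) (V : Set (Eucl d)),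
    ‖e‖ = 1 ∧ ContDiff ℝ 1 γ ∧ IsOpen V ∧ z ∈ V ∧
      ∀ x ∈ V, (x ∈ Ω ↔ γ (perp e x) < inner ℝ e x)

/-- Bounded connected (in particular non-empty) open sets with Lipschitz boundary. -/
structure IsLipschitzDomain (Ω : Set (Eucl d)) : Prop where
  isOpen : IsOpen Ω
  isConnected : IsConnected Ω
  isBounded : Bornology.IsBounded Ω
  lipschitz : HasLipschitzBoundary Ω

/-! ### Function spaces and weak derivatives -/

/-- `φ ∈ C_c^∞(Ω)`: a complex-valued smooth function on `ℝ^d` whose support is a compact subset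
of `Ω`. -/
structure IsTestFunction (Ω : Set (Eucl d)) (φ : Eucl d → ℂ) : Prop where
  smooth : ContDiff ℝ ∞ φ
  compact : HasCompactSupport φ
  support : tsupport φ ⊆ Ω

/-- The classical `j`-th partial derivative. -/
def partialDeriv (j : Fin d) (φ : Eucl d → ℂ) (x : Eucl d) : ℂ :=
  fderiv ℝ φ x (EuclideanSpace.single j 1)

/-- Restriction of a continuous function on `ℝ^d` to an element of `C(S)`. -/
def restr (S : Set (Eucl d)) (f : Eucl d → ℂ) (hf : Continuous f) : C(S, ℂ) :=
  ⟨fun x => f x, hf.comp continuous_subtype_val⟩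

/-- Extension by zero of a continuous function on `S` (used only to write integrals over subsets
of `S`). -/
def zeroExt {S : Set (Eucl d)} (u : C(S, ℂ)) : Eucl d → ℂ :=
  Function.extend Subtype.val u 0

/-- `u ∈ H^1(Ω)` with distributional gradient `G = (G_1, …, G_d)`. -/
structure HasH1Gradient (Ω : Set (Eucl d)) (u : Eucl d → ℂ) (G : Fin d → Eucl d → ℂ) : Prop where
  memLp : MemLp u 2 (volume.restrict Ω)
  memLp_grad : ∀ j, MemLp (G j) 2 (volume.restrict Ω)
  weak : ∀ φ, IsTestFunction Ω φ → ∀ j,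
    ∫ x in Ω, u x * partialDeriv j φ x = - ∫ x in Ω, G j x * φ x

/-- `w = Δ u` in the sense of distributions on `Ω`. -/
def HasDistribLaplacian (Ω : Set (Eucl d)) (u w : Eucl d → ℂ) : Prop :=
  ∀ φ, IsTestFunction Ω φ → ∫ x in Ω, u x * Laplacian.laplacian φ x = ∫ x in Ω, w x * φ x

/-- Surface measure on `∂Ω`: the `(d-1)`-dimensional Hausdorff measure, normalised so as to agree
with Lebesgue measure on hyperplanes. -/
def surface (Ω : Set (Eucl d)) : Measure (Eucl d) :=
  (Measure.euclideanHausdorffMeasure (d - 1)).restrict (frontier Ω)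

/-- `g ∈ L^2(∂Ω)` is the trace of `v ∈ H^1(Ω)` (with gradient `G`): there are `φ_n ∈ C_c^∞(ℝ^d)`
with `φ_n → v` in `H^1(Ω)` and `φ_n → g` in `L^2(∂Ω)`. -/
structure IsTrace (Ω : Set (Eucl d)) (v : Eucl d → ℂ) (G : Fin d → Eucl d → ℂ)
    (g : Eucl d → ℂ) : Prop where
  memLp : MemLp g 2 (surface Ω)
  approx : ∃ φ : ℕ → Eucl d → ℂ, (∀ n, IsTestFunction univ (φ n)) ∧
    Tendsto (fun n => eLpNorm (fun x => φ n x - v x) 2 (volume.restrict Ω)) atTop (𝓝 0) ∧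
    (∀ j, Tendsto (fun n => eLpNorm (fun x => partialDeriv j (φ n) x - G j x) 2
      (volume.restrict Ω)) atTop (𝓝 0)) ∧
    Tendsto (fun n => eLpNorm (fun x => φ n x - g x) 2 (surface Ω)) atTop (𝓝 0)

/-- `u ∈ H^1(Ω)`, `Δ u ∈ L^2(Ω)`, and `h ∈ L^2(∂Ω)` is the distributional outer normal derivative
of `u`: Green's formula
`∫_Ω ∇u · conj ∇v + Δu conj v = ∫_{∂Ω} h conj v dσ` holds for all `v ∈ H^1(Ω)`. -/
def HasNormalDerivative (Ω : Set (Eucl d)) (u h : Eucl d → ℂ) : Prop :=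
  ∃ (G : Fin d → Eucl d → ℂ) (w : Eucl d → ℂ),
    HasH1Gradient Ω u G ∧ MemLp w 2 (volume.restrict Ω) ∧ HasDistribLaplacian Ω u w ∧
    MemLp h 2 (surface Ω) ∧
    ∀ (v : Eucl d → ℂ) (Gv : Fin d → Eucl d → ℂ) (g : Eucl d → ℂ),
      HasH1Gradient Ω v Gv → IsTrace Ω v Gv g →
        ∫ x in Ω, ((∑ j, G j x * conj (Gv j x)) + w x * conj (v x))
          = ∫ x, h x * conj (g x) ∂(surface Ω)

/-! ### The Robin Laplacian on `C(closure Ω)` -/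

/-- The domain of the Robin Laplacian `Δ^β` on `C(closure Ω)`: those
`u ∈ H^1(Ω) ∩ C(closure Ω)` with `Δ u ∈ L^2(Ω) ∩ C(closure Ω)` and `∂u/∂ν = - β u` on `∂Ω`. The
case `β = 0` is the Neumann Laplacian. On its domain, `Δ^β u = Δ u`. -/
def robinDomain (Ω : Set (Eucl d)) (β : C(frontier Ω, ℂ)) : Set C(closure Ω, ℂ) :=
  {u | (∃ G, HasH1Gradient Ω (zeroExt u) G) ∧
    (∃ w : C(closure Ω, ℂ), MemLp (zeroExt w) 2 (volume.restrict Ω) ∧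
      HasDistribLaplacian Ω (zeroExt u) (zeroExt w)) ∧
    HasNormalDerivative Ω (zeroExt u) (fun x => - zeroExt β x * zeroExt u x)}

/-! ### Assumptions on the operator -/

/-- `U` preserves disjointness. -/
def DisjointnessPreserving {S T : Set (Eucl d)} (U : C(S, ℂ) →L[ℂ] C(T, ℂ)) : Prop :=
  ∀ f g : C(S, ℂ), f * g = 0 → U f * U g = 0

theorem continuous_laplacian {f : Eucl d → ℂ} (hf : ContDiff ℝ ∞ f) :
    Continuous (Laplacian.laplacian f) := by
  rw [laplacian_eq_iteratedFDeriv_orthonormalBasis f (EuclideanSpace.basisFun (Fin d) ℝ)]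
  refine continuous_finsetSum _ fun i _ => ?_
  have h := (contDiff_infty.mp hf 2).continuous_iteratedFDeriv (m := 2) (by norm_cast)
  fun_prop

/-- `U` maps `C_c^∞(Ω₁)` into the domain of the Robin Laplacian `Δ^β` on `C(closure Ω₂)`, and
`U (Δ f) = Δ (U f)` for all `f ∈ C_c^∞(Ω₁)`. -/
def IntertwinesOnTestFunctions {Ω₁ Ω₂ : Set (Eucl d)} (β : C(frontier Ω₂, ℂ))
    (U : C(closure Ω₁, ℂ) →L[ℂ] C(closure Ω₂, ℂ)) : Prop :=
  ∀ (f : Eucl d → ℂ) (hf : IsTestFunction Ω₁ f),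
    U (restr (closure Ω₁) f hf.smooth.continuous) ∈ robinDomain Ω₂ β ∧
    HasDistribLaplacian Ω₂ (zeroExt (U (restr (closure Ω₁) f hf.smooth.continuous)))
      (zeroExt (U (restr (closure Ω₁) (Laplacian.laplacian f) (continuous_laplacian hf.smooth))))

/-- The only open `W ⊆ Ω₂` on which `U f` vanishes for all `f ∈ C_c^∞(Ω₁)` is the empty set. -/
def NonDegenerate {Ω₁ Ω₂ : Set (Eucl d)}
    (U : C(closure Ω₁, ℂ) →L[ℂ] C(closure Ω₂, ℂ)) : Prop :=
  ∀ W : Set (Eucl d), IsOpen W → W ⊆ Ω₂ →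
    (∀ (f : Eucl d → ℂ) (hf : IsTestFunction Ω₁ f) (y : closure Ω₂), (y : Eucl d) ∈ W →
      U (restr (closure Ω₁) f hf.smooth.continuous) y = 0) → W = ∅

end RobinIntertwining

end

open RobinIntertwining

open MeasureTheory Filter Topology Set InnerProductSpace
open scoped ContDiff ENNReal NNReal ComplexConjugate

namespace RobinIntertwining

variable {d : ℕ}

/-! Composing `U` with evaluation at `y` gives a disjointness preserving functional on `C(closure
Ω₁)`, which must be a multiple of a point evaluation (`exists_eq_mul_eval`). Hence `U f y = h y * f
(T y)` with `h = U 1`, and `T` is continuous where `h ≠ 0`. Let `W` be the open set of points of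
`Ω₂` with `h ≠ 0` and `T y ∈ Ω₁`; non-degeneracy makes it dense in `Ω₂`.

On `W` the intertwining relation can be tested, after a cutoff, with constants, coordinates and
products of two coordinates. Weyl's lemma (`contDiffOn_of_distrib_harmonic`) makes `h` and `T`
smooth, and the product rule then gives orthonormal gradients for the components of `T`. So on each
component of `W` the map `T` is an affine isometry `A` and `h` is a nonzero constant
(`exists_affineIsometry_of_intertwines`).

Each component is a full copy `A ⁻¹' Ω₁`. Otherwise it would have a limit point on `∂Ω₂` sent into
`Ω₁`; near that point the functions `U f` would include every test function up to a constant factor,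
all subject to one Robin condition. The function `1` would force `β` to vanish weakly, and then the
coordinates would force the normal to vanish (`not_forall_robin`).

Thus `Ω₂` is tiled by copies of `Ω₁`, finitely many by volume, whose isometries agree on shared
boundaries because `T` is continuous there. At an interface point the `C¹` normals of two tiles are
opposite, and agreement of the isometries makes the interface a piece of hyperplane. Following it in
a tangent direction, which exists since `d ≥ 2`, leads to a point of `∂Ω₂` where both open half
spaces of directions enter `Ω₂`; this contradicts the exterior cone condition
(`no_common_boundary`). Connectedness of `Ω₂` then leaves a single tile (`eq_of_tiling`). -/

/-! ### Exterior cones and inner normals -/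

theorem perp_add_smul_self {e : Eucl d} (he : ‖e‖ = 1) (x : Eucl d) (t : ℝ) :
    perp e (x + t • e) = perp e x := by
  simp only [perp, inner_add_right, inner_smul_right, real_inner_self_eq_norm_sq, he]
  module

theorem perp_add (e x y : Eucl d) : perp e (x + y) = perp e x + perp e y := by
  simp only [perp, inner_add_right]; module

theorem perp_smul (e x : Eucl d) (t : ℝ) : perp e (t • x) = t • perp e x := by
  simp only [perp, inner_smul_right]; module

theorem continuous_perp (e : Eucl d) : Continuous (perp e) := by
  unfold perp; fun_prop

theorem norm_perp_le {e : Eucl d} (he : ‖e‖ = 1) (x : Eucl d) : ‖perp e x‖ ≤ 2 * ‖x‖ := by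
  unfold perp
  have h1 := norm_sub_le x ((inner ℝ e x) • e)
  have h2 := norm_inner_le_norm (𝕜 := ℝ) e x
  rw [norm_smul, he] at h1
  rw [he] at h2
  linarith

/-- A boundary point of an open set given locally as a strict epigraph lies on the graph. -/
theorem eq_of_mem_frontier {Ω V : Set (Eucl d)} (hΩ : IsOpen Ω) (hV : IsOpen V) {z : Eucl d}
    (hz : z ∈ frontier Ω) (hzV : z ∈ V) {F : Eucl d → ℝ} (hF : ContinuousAt F z)
    (h : ∀ x ∈ V, (x ∈ Ω ↔ 0 < F x)) : F z = 0 := by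
  have hzΩ : z ∉ Ω := fun hz' => by
    rw [hΩ.frontier_eq] at hz; exact hz.2 hz'
  apply le_antisymm
  · by_contra! hlt
    exact hzΩ ((h z hzV).2 hlt)
  · by_contra! hlt
    have h1 : ∀ᶠ x in 𝓝 z, F x < 0 ∧ x ∈ V := (hF.eventually (gt_mem_nhds hlt)).and (hV.mem_nhds hzV)
    have h2 := (mem_closure_iff_frequently.1 (frontier_subset_closure hz)).and_eventually h1
    obtain ⟨x, hx, hx1, hx2⟩ := h2.exists
    exact absurd ((h x hx2).1 hx) (not_lt.2 hx1.le)

/-- Lipschitz sets satisfy an exterior cone condition. -/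
theorem HasLipschitzBoundary.exterior_cone {Ω : Set (Eucl d)} (hΩ : IsOpen Ω)
    (hL : HasLipschitzBoundary Ω) {z : Eucl d} (hz : z ∈ frontier Ω) :
    ∃ O : Set (Eucl d), IsOpen O ∧ O.Nonempty ∧
      ∀ w ∈ O, ∀ᶠ t in 𝓝[>] (0 : ℝ), z + t • w ∉ closure Ω := by
  obtain ⟨e, γ, K, V, he, hγ, hV, hzV, hiff⟩ := hL z hz
  have hF : Continuous fun x => inner ℝ e x - γ (perp e x) := by
    have := hγ.continuous; have := continuous_perp e; fun_prop
  have h0 := eq_of_mem_frontier hΩ hV hz hzV hF.continuousAt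
    (fun x hx => by rw [hiff x hx, sub_pos])
  -- Downward directions steeper than the Lipschitz constant: along them the height above the graph
  -- becomes strictly negative.
  refine ⟨{w | inner ℝ e w + K * ‖perp e w‖ < 0}, ?_, ⟨-e, ?_⟩, ?_⟩
  · have := continuous_perp e
    exact isOpen_lt (by fun_prop) continuous_const
  · have : perp e (-e) = 0 := by simp [perp, he]
    simp [this, he]
  · intro w hw
    have hc : Tendsto (fun t : ℝ => z + t • w) (𝓝[>] 0) (𝓝 z) := by
      have : Continuous (fun t : ℝ => z + t • w) := by fun_prop
      have := this.tendsto 0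
      simp only [zero_smul, add_zero] at this
      exact this.mono_left nhdsWithin_le_nhds
    filter_upwards [hc.eventually (hV.mem_nhds hzV), self_mem_nhdsWithin] with t ht ht0 hcl
    have hneg : inner ℝ e (z + t • w) - γ (perp e (z + t • w)) < 0 := by
      have h1 := hγ.dist_le_mul (perp e (z + t • w)) (perp e z)
      rw [Real.dist_eq, dist_eq_norm, perp_add, perp_smul, add_sub_cancel_left, norm_smul,
        Real.norm_of_nonneg (le_of_lt ht0)] at h1
      have h2 := neg_abs_le (γ (perp e z + t • perp e w) - γ (perp e z))
      rw [perp_add, perp_smul, inner_add_right, inner_smul_right]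
      have h3 := mul_neg_of_pos_of_neg ht0 (show _ < (0 : ℝ) from hw)
      linarith
    have h1 : ∀ᶠ x in 𝓝 (z + t • w), inner ℝ e x - γ (perp e x) < 0 ∧ x ∈ V :=
      (hF.continuousAt.eventually (gt_mem_nhds hneg)).and (hV.mem_nhds ht)
    obtain ⟨x, hx, hx1, hx2⟩ := ((mem_closure_iff_frequently.1 hcl).and_eventually h1).exists
    exact absurd ((hiff x hx2).1 hx) (by linarith)

theorem tendsto_add_smul_nhdsGT (z w : Eucl d) :
    Tendsto (fun t : ℝ => z + t • w) (𝓝[>] 0) (𝓝 z) := by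
  have : Continuous (fun t : ℝ => z + t • w) := by fun_prop
  have := this.tendsto 0
  simp only [zero_smul, add_zero] at this
  exact this.mono_left nhdsWithin_le_nhds

theorem HasLipschitzBoundary.frontier_subset_closure_compl {Ω : Set (Eucl d)} (hΩ : IsOpen Ω)
    (hL : HasLipschitzBoundary Ω) : frontier Ω ⊆ closure (closure Ω)ᶜ := by
  intro z hz
  obtain ⟨O, -, ⟨w, hw⟩, h⟩ := hL.exterior_cone hΩ hz
  exact mem_closure_of_tendsto (tendsto_add_smul_nhdsGT z w) (h w hw)

/-- A Lipschitz set has no slits, since every boundary point is a limit of exterior points. This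
recovers a tile from its closure. -/
theorem HasLipschitzBoundary.interior_closure {Ω : Set (Eucl d)} (hΩ : IsOpen Ω)
    (hL : HasLipschitzBoundary Ω) : interior (closure Ω) = Ω := by
  refine subset_antisymm (fun x hx => ?_) (interior_maximal subset_closure hΩ)
  by_contra hxΩ
  have hf : x ∈ frontier Ω := by
    rw [hΩ.frontier_eq]; exact ⟨interior_subset hx, hxΩ⟩
  have := hL.frontier_subset_closure_compl hΩ hf
  rw [closure_compl] at this
  exact this hx

/-- `n` is an inner normal of `Ω` at `z`: all directions in the open half space around `n` enter
`Ω`. -/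
def IsInnerNormal (Ω : Set (Eucl d)) (z n : Eucl d) : Prop :=
  n ≠ 0 ∧ ∀ w, 0 < inner ℝ w n → ∀ᶠ t in 𝓝[>] (0 : ℝ), z + t • w ∈ Ω

/-- The normal is the gradient at `z` of `F`, the height above the graph. It is nonzero because `F`
has slope 1 along `e`, and `F z = 0` turns a positive directional derivative into `F > 0` for small
`t`. -/
theorem HasC1Boundary.exists_isInnerNormal {Ω : Set (Eucl d)} (hΩ : IsOpen Ω)
    (hC : HasC1Boundary Ω) {z : Eucl d} (hz : z ∈ frontier Ω) : ∃ n, IsInnerNormal Ω z n := by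
  obtain ⟨e, γ, V, he, hγ, hV, hzV, hiff⟩ := hC z hz
  set F : Eucl d → ℝ := fun x => inner ℝ e x - γ (perp e x) with hFdef
  have hF : ContDiff ℝ 1 F := by
    have : ContDiff ℝ 1 (perp e) := 
      contDiff_id.sub ((contDiff_const.inner ℝ contDiff_id).smul contDiff_const)
    exact (contDiff_const.inner ℝ contDiff_id).sub (hγ.comp this)
  have h0 : F z = 0 := eq_of_mem_frontier hΩ hV hz hzV hF.continuous.continuousAt
    (fun x hx => by rw [hiff x hx, hFdef, sub_pos])
  have hD : HasFDerivAt F (fderiv ℝ F z) z := (hF.differentiable one_ne_zero z).hasFDerivAt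
  have hline : ∀ w : Eucl d, HasDerivAt (fun t : ℝ => F (z + t • w)) (fderiv ℝ F z w) 0 := by
    intro w
    have h1 : HasDerivAt (fun t : ℝ => z + t • w) w 0 := by
      simpa using ((hasDerivAt_id (0 : ℝ)).smul_const w).const_add z
    have hD' : HasFDerivAt F (fderiv ℝ F z) (z + (0 : ℝ) • w) := by simpa using hD
    exact hD'.comp_hasDerivAt 0 h1
  refine ⟨(InnerProductSpace.toDual ℝ (Eucl d)).symm (fderiv ℝ F z), fun hn => ?_, fun w hw => ?_⟩
  · have h1 := hline e
    have h2 : (fun t : ℝ => F (z + t • e)) = fun t => F z + t := by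
      funext t
      simp only [hFdef, perp_add_smul_self he, inner_add_right, inner_smul_right,
        real_inner_self_eq_norm_sq, he]
      ring
    rw [h2] at h1
    have h3 := h1.unique ((hasDerivAt_id (0 : ℝ)).const_add (F z))
    rw [LinearIsometryEquiv.map_eq_zero_iff] at hn
    simp [hn] at h3
  · rw [real_inner_comm, InnerProductSpace.toDual_symm_apply] at hw
    have h1 := (hline w).hasDerivWithinAt (s := Ioi 0)
    have h2 := (hasDerivWithinAt_iff_tendsto_slope' (by simp)).1 h1
    filter_upwards [h2.eventually (lt_mem_nhds hw), self_mem_nhdsWithin,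
      (tendsto_add_smul_nhdsGT z w).eventually (hV.mem_nhds hzV)] with t ht ht0 htV
    rw [hiff _ htV, ← sub_pos]
    have ht0' : (0:ℝ) < t := ht0
    simp only [slope, zero_smul, add_zero, h0, vsub_eq_sub, sub_zero, smul_eq_mul] at ht
    exact pos_of_mul_pos_right ht (inv_nonneg.2 ht0'.le)

theorem IsInnerNormal.preimage {Ω : Set (Eucl d)} (A : Eucl d ≃ᵃⁱ[ℝ] Eucl d) {q n : Eucl d}
    (h : IsInnerNormal Ω (A q) n) :
    IsInnerNormal (A ⁻¹' Ω) q (A.linearIsometryEquiv.symm n) := by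
  refine ⟨by simpa using h.1, fun w hw => ?_⟩
  have := h.2 (A.linearIsometryEquiv w) (by
    rw [← A.linearIsometryEquiv.symm.inner_map_map]; simpa using hw)
  filter_upwards [this] with t ht
  have e1 : A (q + t • w) = A q + t • A.linearIsometryEquiv w := by
    have := A.map_vadd q (t • w)
    simpa [add_comm] using this
  simpa [mem_preimage, e1] using ht

/-- If two normals of equal length are not opposite, their sum has positive inner product with both,
so this one direction enters both sets. -/
theorem IsInnerNormal.eq_neg_of_disjoint {S S' : Set (Eucl d)} (hd : Disjoint S S')
    {q n n' : Eucl d} (h : IsInnerNormal S q n) (h' : IsInnerNormal S' q n')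
    (hn : ‖n‖ = ‖n'‖) : n' = -n := by
  by_contra hne
  have hpos : 0 < ‖n + n'‖ := norm_pos_iff.2 fun h0 => hne (by
    rw [eq_neg_iff_add_eq_zero, add_comm]; exact h0)
  have hsq := norm_add_sq_real n n'
  have hpos2 := pow_pos hpos 2
  rw [hsq] at hpos2
  have h1 : 0 < inner ℝ (n + n') n := by
    rw [inner_add_left, real_inner_self_eq_norm_sq, real_inner_comm]
    rw [← hn] at hpos2; linarith
  have h2 : 0 < inner ℝ (n + n') n' := by
    rw [inner_add_left, real_inner_self_eq_norm_sq]
    rw [hn] at hpos2; linarith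
  obtain ⟨t, ht, ht'⟩ := ((h.2 _ h1).and (h'.2 _ h2)).exists
  exact hd.le_bot ⟨ht, ht'⟩

theorem AffineIsometryEquiv.map_add_vec (A : Eucl d ≃ᵃⁱ[ℝ] Eucl d) (q w : Eucl d) :
    A (q + w) = A q + A.linearIsometryEquiv w := by
  have := A.map_vadd q w
  simpa [add_comm] using this

theorem mem_frontier_preimage (A : Eucl d ≃ᵃⁱ[ℝ] Eucl d) {Ω : Set (Eucl d)} {q : Eucl d}
    (h : q ∈ frontier (A ⁻¹' Ω)) : A q ∈ frontier Ω := by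
  have := A.toHomeomorph.preimage_frontier Ω
  have h' : q ∈ A.toHomeomorph ⁻¹' frontier Ω := by rw [this]; exact h
  exact h'

/-! ### Tilings by congruent copies -/

/-- The common boundary, inside `Ω₂`, of two disjoint congruent `C¹` pieces whose congruences agree
on this common boundary is, near each of its points, a piece of a hyperplane. -/
theorem common_boundary_flat {Ω₁ Ω₂ : Set (Eucl d)} (hΩ₂ : IsOpen Ω₂)
    (A A' : Eucl d ≃ᵃⁱ[ℝ] Eucl d) (hS : IsOpen Ω₁)
    (hagree : ∀ q ∈ Ω₂ ∩ (closure (A ⁻¹' Ω₁) ∩ closure (A' ⁻¹' Ω₁)), A q = A' q)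
    {q n : Eucl d} (hq : q ∈ Ω₂ ∩ (closure (A ⁻¹' Ω₁) ∩ closure (A' ⁻¹' Ω₁)))
    (hcov : closure (A ⁻¹' Ω₁) ∪ closure (A' ⁻¹' Ω₁) ∈ 𝓝 q)
    (hn : IsInnerNormal (A ⁻¹' Ω₁) q n) (hn' : IsInnerNormal (A' ⁻¹' Ω₁) q (-n))
    (hR : A.linearIsometryEquiv n = - A'.linearIsometryEquiv n) :
    ∃ ε > 0, ∀ w, inner ℝ w n = 0 → ‖w‖ < ε →
      q + w ∈ Ω₂ ∩ (closure (A ⁻¹' Ω₁) ∩ closure (A' ⁻¹' Ω₁)) ∧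
        A.linearIsometryEquiv w = A'.linearIsometryEquiv w := by
  set S := A ⁻¹' Ω₁ with hSdef
  set S' := A' ⁻¹' Ω₁ with hS'def
  have hSo : IsOpen S := hS.preimage A.continuous
  have hSo' : IsOpen S' := hS.preimage A'.continuous
  have hnn : 0 < inner ℝ n n := by
    rw [real_inner_self_eq_norm_sq]; have := norm_pos_iff.2 hn.1; positivity
  obtain ⟨r, hr, hball⟩ := Metric.mem_nhds_iff.1 (inter_mem (hΩ₂.mem_nhds hq.1) hcov)
  obtain ⟨δ, hδ1, hδ2, hδ3, hδ0⟩ := ((hn.2 n hnn).and ((hn'.2 (-n) (by simpa using hnn)).and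
    (((tendsto_add_smul_nhdsGT 0 n).eventually (Metric.ball_mem_nhds 0 (half_pos hr))).and
      self_mem_nhdsWithin))).exists
  have hδ0 : 0 < δ := hδ0
  rw [zero_add, dist_zero_right, norm_smul, Real.norm_of_nonneg hδ0.le] at hδ3
  have ev : ∀ᶠ w : Eucl d in 𝓝 0, (q + w) + δ • n ∈ S ∧ (q + w) + δ • -n ∈ S' := by
    have c1 : Tendsto (fun w : Eucl d => (q + w) + δ • n) (𝓝 0) (𝓝 (q + δ • n)) := by
      have : Continuous (fun w : Eucl d => (q + w) + δ • n) := by fun_prop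
      simpa using this.tendsto 0
    have c2 : Tendsto (fun w : Eucl d => (q + w) + δ • -n) (𝓝 0) (𝓝 (q + δ • -n)) := by
      have : Continuous (fun w : Eucl d => (q + w) + δ • -n) := by fun_prop
      simpa using this.tendsto 0
    exact (c1.eventually (hSo.mem_nhds hδ1)).and (c2.eventually (hSo'.mem_nhds hδ2))
  obtain ⟨ε, hε, hεb⟩ := Metric.mem_nhds_iff.1 ev
  refine ⟨min ε (r / 2), lt_min hε (half_pos hr), fun w hwn hw => ?_⟩
  obtain ⟨h1, h2⟩ := hεb (mem_ball_zero_iff.2 (hw.trans_le (min_le_left _ _)))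
  have hw2 := hw.trans_le (min_le_right _ _)
  have hin : ∀ s ∈ Icc (-δ) δ, (q + w) + s • n ∈ Ω₂ ∩ (closure S ∪ closure S') := by
    intro s hs
    apply hball
    rw [Metric.mem_ball, dist_eq_norm, add_assoc, add_sub_cancel_left]
    have h3 := norm_add_le w (s • n)
    rw [norm_smul, Real.norm_eq_abs] at h3
    have h4 : |s| * ‖n‖ ≤ δ * ‖n‖ :=
      mul_le_mul_of_nonneg_right (abs_le.2 hs) (norm_nonneg _)
    linarith
  -- The segment through `q + w` along `n` is covered by the two closed sets and has an end in each,
  -- so they meet on it.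
  have hpre : IsPreconnected ((fun s : ℝ => (q + w) + s • n) '' Icc (-δ) δ) :=
    isPreconnected_Icc.image _ (by fun_prop)
  have hne := isPreconnected_closed_iff.1 hpre (closure S) (closure S') isClosed_closure
    isClosed_closure (by rintro _ ⟨s, hs, rfl⟩; exact (hin s hs).2)
    ⟨_, ⟨δ, ⟨by linarith, le_rfl⟩, rfl⟩, subset_closure h1⟩
    ⟨_, ⟨-δ, ⟨le_rfl, by linarith⟩, rfl⟩, subset_closure (by simpa using h2)⟩
  obtain ⟨_, ⟨s, hs, rfl⟩, hx⟩ := hne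
  have hxF : (q + w) + s • n ∈ Ω₂ ∩ (closure S ∩ closure S') := ⟨(hin s hs).1, hx⟩
  have hA := hagree _ hxF
  rw [add_assoc, AffineIsometryEquiv.map_add_vec, AffineIsometryEquiv.map_add_vec, hagree q hq,
    add_right_inj, map_add, map_add, map_smul, map_smul, hR] at hA
  -- Pairing `hA` with `R' n`, for the linear parts `R`, `R'`: the terms in `w` vanish because `w ⟂
  -- n`, and `R n = -R' n` leaves `-s ‖n‖² = s ‖n‖²`.
  have hs0 : s = 0 := by
    have h5 := congrArg (fun x => inner ℝ x (A'.linearIsometryEquiv n)) hA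
    have h6 : inner ℝ (A.linearIsometryEquiv w) (A'.linearIsometryEquiv n) = (0 : ℝ) := by
      have : A'.linearIsometryEquiv n = - A.linearIsometryEquiv n := by rw [hR, neg_neg]
      rw [this, inner_neg_right, LinearIsometryEquiv.inner_map_map, hwn, neg_zero]
    simp only [inner_add_left, h6, inner_smul_left, inner_neg_left,
      LinearIsometryEquiv.inner_map_map, hwn, RCLike.conj_to_real] at h5
    have h7 : s * inner ℝ n n = 0 := by linarith
    exact (mul_eq_zero.1 h7).resolve_right hnn.ne'
  subst hs0
  simp only [zero_smul, add_zero] at hxF hA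
  exact ⟨hxF, hA⟩

/-- Two disjoint congruent `C¹` pieces of a bounded Lipschitz domain whose congruences agree on the
common boundary, and which are locally the only ones, do not touch inside the domain. -/
theorem no_common_boundary (hd : 2 ≤ d) {Ω₁ Ω₂ : Set (Eucl d)} (hΩ₂ : IsLipschitzDomain Ω₂)
    (hS : IsOpen Ω₁) (hC1 : HasC1Boundary Ω₁)
    (A A' : Eucl d ≃ᵃⁱ[ℝ] Eucl d) (hdisj : Disjoint (A ⁻¹' Ω₁) (A' ⁻¹' Ω₁))
    (hsub : A ⁻¹' Ω₁ ⊆ Ω₂) (hsub' : A' ⁻¹' Ω₁ ⊆ Ω₂)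
    (hagree : ∀ q ∈ Ω₂ ∩ (closure (A ⁻¹' Ω₁) ∩ closure (A' ⁻¹' Ω₁)), A q = A' q)
    (hcov : ∀ q ∈ Ω₂ ∩ (closure (A ⁻¹' Ω₁) ∩ closure (A' ⁻¹' Ω₁)),
      closure (A ⁻¹' Ω₁) ∪ closure (A' ⁻¹' Ω₁) ∈ 𝓝 q) :
    Ω₂ ∩ (closure (A ⁻¹' Ω₁) ∩ closure (A' ⁻¹' Ω₁)) = ∅ := by
  set F := Ω₂ ∩ (closure (A ⁻¹' Ω₁) ∩ closure (A' ⁻¹' Ω₁)) with hF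
  have hSo : IsOpen (A ⁻¹' Ω₁) := hS.preimage A.continuous
  have hSo' : IsOpen (A' ⁻¹' Ω₁) := hS.preimage A'.continuous
  have normals : ∀ q ∈ closure (A ⁻¹' Ω₁) ∩ closure (A' ⁻¹' Ω₁), A q = A' q →
      ∃ n, IsInnerNormal (A ⁻¹' Ω₁) q n ∧ IsInnerNormal (A' ⁻¹' Ω₁) q (-n) ∧
        A.linearIsometryEquiv n = - A'.linearIsometryEquiv n := by
    intro q hq hAq
    have hfr : q ∈ frontier (A ⁻¹' Ω₁) := by
      rw [hSo.frontier_eq]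
      exact ⟨hq.1, fun h => (hdisj.closure_right hSo).le_bot ⟨h, hq.2⟩⟩
    obtain ⟨m, hm⟩ := hC1.exists_isInnerNormal hS (mem_frontier_preimage A hfr)
    have h1 := hm.preimage A
    have h2 := (hAq ▸ hm).preimage A'
    have h3 := h1.eq_neg_of_disjoint hdisj h2 (by simp)
    refine ⟨_, h1, h3 ▸ h2, ?_⟩
    rw [LinearIsometryEquiv.apply_symm_apply]
    have := congrArg A'.linearIsometryEquiv h3
    rwa [LinearIsometryEquiv.apply_symm_apply, map_neg] at this
  by_contra hne
  obtain ⟨q₀, hq₀⟩ := nonempty_iff_ne_empty.2 hne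
  obtain ⟨n₀, hn₀, hn₀', hR₀⟩ := normals q₀ hq₀.2 (hagree q₀ hq₀)
  obtain ⟨ε₀, hε₀, hflat₀⟩ := common_boundary_flat hΩ₂.isOpen A A' hS hagree hq₀ (hcov q₀ hq₀)
    hn₀ hn₀' hR₀
  -- Here `d ≥ 2` enters: the orthogonal complement of the normal is nontrivial.
  obtain ⟨w₁, hw₁, hw₁n⟩ : ∃ w : Eucl d, w ≠ 0 ∧ inner ℝ w n₀ = 0 := by
    have hfin : Module.finrank ℝ (ℝ ∙ n₀)ᗮ + 1 = d := by
      have h1 := (ℝ ∙ n₀).finrank_add_finrank_orthogonal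
      rw [finrank_span_singleton hn₀.1, finrank_euclideanSpace_fin] at h1
      omega
    have hpos : 0 < Module.finrank ℝ (ℝ ∙ n₀)ᗮ := by omega
    have := Module.finrank_pos_iff_exists_ne_zero.1 hpos
    obtain ⟨⟨w, hw⟩, hw0⟩ := this
    refine ⟨w, fun h => hw0 (by simpa using h), ?_⟩
    rw [real_inner_comm]
    exact Submodule.mem_orthogonal_singleton_iff_inner_right.1 hw
  obtain ⟨w₀, hw₀, hRw⟩ : ∃ w : Eucl d, w ≠ 0 ∧ A.linearIsometryEquiv w = A'.linearIsometryEquiv w := by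
    have hw1 := norm_pos_iff.2 hw₁
    refine ⟨(ε₀ / (2 * ‖w₁‖)) • w₁, smul_ne_zero (by positivity) hw₁, (hflat₀ _ ?_ ?_).2⟩
    · rw [inner_smul_left, hw₁n, mul_zero]
    · rw [norm_smul, Real.norm_of_nonneg (by positivity)]
      field_simp
      linarith
  have hstep : ∀ q ∈ F, ∃ ε > 0, ∀ t : ℝ, |t| < ε → q + t • w₀ ∈ F := by
    intro q hq
    obtain ⟨n, hn, hn', hR⟩ := normals q hq.2 (hagree q hq)
    obtain ⟨ε, hε, hflat⟩ := common_boundary_flat hΩ₂.isOpen A A' hS hagree hq (hcov q hq)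
      hn hn' hR
    have hw1 := norm_pos_iff.2 hw₀
    -- The linear parts agree on `w₀` and are opposite on `n`, so `⟨w₀, n⟩ = -⟨w₀, n⟩`. Hence `w₀`,
    -- chosen at `q₀`, is tangent at every interface point.
    have horth : inner ℝ w₀ n = 0 := by
      have h1 := A.linearIsometryEquiv.inner_map_map w₀ n
      have h2 := A'.linearIsometryEquiv.inner_map_map w₀ n
      rw [hRw, hR, inner_neg_right, h2] at h1
      linarith
    refine ⟨ε / ‖w₀‖, by positivity, fun t ht => (hflat _ ?_ ?_).1⟩
    · rw [inner_smul_left, horth, mul_zero]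
    · rw [norm_smul, Real.norm_eq_abs]
      exact (lt_div_iff₀ hw1).1 ht
  set T : Set ℝ := {t | q₀ + t • w₀ ∈ F} with hT
  have hTo : IsOpen T := by
    rw [Metric.isOpen_iff]
    intro t ht
    obtain ⟨ε, hε, h⟩ := hstep _ ht
    refine ⟨ε, hε, fun s hs => ?_⟩
    have := h (s - t) hs
    rwa [add_assoc, ← add_smul, add_sub_cancel] at this
  have hTne : T ≠ univ := by
    intro hu
    obtain ⟨R, hR⟩ := hΩ₂.isBounded.exists_norm_le
    have hw1 := norm_pos_iff.2 hw₀
    have h1 : ∀ t, q₀ + t • w₀ ∈ F := fun t => (hu ▸ mem_univ t : t ∈ T)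
    have h2 := hR _ (h1 ((R + ‖q₀‖ + 1) / ‖w₀‖)).1
    have h3 := norm_sub_norm_le (((R + ‖q₀‖ + 1) / ‖w₀‖) • w₀) (-q₀)
    have h4 : 0 ≤ R := (norm_nonneg _).trans (hR q₀ hq₀.1)
    rw [norm_smul, Real.norm_of_nonneg (by positivity), div_mul_cancel₀ _ hw1.ne', sub_neg_eq_add,
      add_comm _ q₀, norm_neg] at h3
    linarith
  have hTcl : ¬ IsClosed T := by
    intro hcl
    rcases isClopen_iff.1 ⟨hcl, hTo⟩ with h | h
    · have : (0 : ℝ) ∈ T := by simpa [hT] using hq₀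
      rw [h] at this; exact this
    · exact hTne h
  -- At such a time the line leaves `F`. The two closures are closed, so only membership in `Ω₂` can
  -- fail, and `p` lies on `∂Ω₂`.
  obtain ⟨t, htcl, htT⟩ : ∃ t, t ∈ closure T ∧ t ∉ T := by
    by_contra! h
    exact hTcl (isClosed_of_closure_subset h)
  set p := q₀ + t • w₀ with hp
  have hcont : Continuous fun t : ℝ => q₀ + t • w₀ := by fun_prop
  have hpF : p ∈ closure F :=
    map_mem_closure (f := fun t : ℝ => q₀ + t • w₀) hcont htcl (fun s hs => hs)
  have hpS : p ∈ closure (A ⁻¹' Ω₁) ∩ closure (A' ⁻¹' Ω₁) :=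
    ⟨closure_minimal (fun x hx => hx.2.1) isClosed_closure hpF,
      closure_minimal (fun x hx => hx.2.2) isClosed_closure hpF⟩
  have hpΩ : p ∈ frontier Ω₂ := by
    rw [hΩ₂.isOpen.frontier_eq]
    exact ⟨closure_mono (fun x hx => hx.1) hpF, fun h => htT ⟨h, hpS⟩⟩
  have hAp : A p = A' p := by
    have : IsClosed {x | A x = A' x} := isClosed_eq A.continuous A'.continuous
    exact closure_minimal (fun x hx => hagree x hx) this hpF
  obtain ⟨n, hn, hn', -⟩ := normals p hpS hAp
  obtain ⟨O, hO, ⟨w, hw⟩, hcone⟩ := hΩ₂.lipschitz.exterior_cone hΩ₂.isOpen hpΩ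
  -- Every direction off the hyperplane `n^⊥` enters one of the two pieces and hence `Ω₂`. The
  -- exterior directions `O` would all lie in this hyperplane, impossible for a nonempty open set.
  have key : ∀ w ∈ O, inner ℝ w n = 0 := by
    intro w hw
    by_contra hne
    rcases lt_or_gt_of_ne hne with h | h
    · obtain ⟨s, hs1, hs2⟩ := ((hn'.2 w (by simpa using h)).and (hcone w hw)).exists
      exact hs2 (subset_closure (hsub' hs1))
    · obtain ⟨s, hs1, hs2⟩ := ((hn.2 w h).and (hcone w hw)).exists
      exact hs2 (subset_closure (hsub hs1))
  obtain ⟨s, hs1, hs2⟩ := (((tendsto_add_smul_nhdsGT w n).eventually (hO.mem_nhds hw)).and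
    self_mem_nhdsWithin).exists
  have h1 := key _ hs1
  rw [inner_add_left, key w hw, zero_add, inner_smul_left] at h1
  have h2 : inner ℝ n n ≠ (0 : ℝ) := by
    rw [real_inner_self_eq_norm_sq]; exact pow_ne_zero _ (norm_ne_zero_iff.2 hn.1)
  exact (mul_ne_zero (show s ≠ 0 from ne_of_gt hs2) h2) (by simpa using h1)

/-- A bounded Lipschitz domain that is tiled by finitely many congruent copies of a `C¹` domain,
with congruences agreeing on common boundaries, consists of a single copy. -/
theorem eq_of_tiling (hd : 2 ≤ d) {Ω₁ Ω₂ : Set (Eucl d)} (hΩ₁ : IsLipschitzDomain Ω₁)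
    (hΩ₂ : IsLipschitzDomain Ω₂) (hC1 : HasC1Boundary Ω₁)
    {ι : Type*} [Finite ι] (A : ι → Eucl d ≃ᵃⁱ[ℝ] Eucl d)
    (hdisj : ∀ i j, i ≠ j → Disjoint (A i ⁻¹' Ω₁) (A j ⁻¹' Ω₁))
    (hsub : ∀ i, A i ⁻¹' Ω₁ ⊆ Ω₂) (hdense : Ω₂ ⊆ closure (⋃ i, A i ⁻¹' Ω₁))
    (hagree : ∀ i j, ∀ q ∈ Ω₂ ∩ (closure (A i ⁻¹' Ω₁) ∩ closure (A j ⁻¹' Ω₁)), A i q = A j q)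
    (i : ι) : A i ⁻¹' Ω₁ = Ω₂ := by
  have hS := hΩ₁.isOpen
  have hSo : ∀ i, IsOpen (A i ⁻¹' Ω₁) := fun i => hS.preimage (A i).continuous
  have hcl : closure (⋃ i, A i ⁻¹' Ω₁) = ⋃ i, closure (A i ⁻¹' Ω₁) := closure_iUnion_of_finite _
  have hempty : ∀ i j, i ≠ j → Ω₂ ∩ (closure (A i ⁻¹' Ω₁) ∩ closure (A j ⁻¹' Ω₁)) = ∅ := by
    intro i j hij
    refine no_common_boundary hd hΩ₂ hS hC1 (A i) (A j) (hdisj i j hij) (hsub i) (hsub j)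
      (hagree i j) fun q hq => ?_
    -- At most two tiles meet at `q`: all isometries send `q` to the same point, so the pulled-back
    -- normals have equal length, and three nonzero vectors cannot be pairwise opposite.
    have h3 : ∀ k, k ≠ i → k ≠ j → q ∉ closure (A k ⁻¹' Ω₁) := by
      intro k hki hkj hqk
      have hfr : q ∈ frontier (A i ⁻¹' Ω₁) := by
        rw [(hSo i).frontier_eq]
        exact ⟨hq.2.1, fun h => ((hdisj i j hij).closure_right (hSo i)).le_bot ⟨h, hq.2.2⟩⟩
      obtain ⟨m, hm⟩ := hC1.exists_isInnerNormal hS (mem_frontier_preimage _ hfr)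
      have hi := hm.preimage (A i)
      have hj := ((hagree i j q hq) ▸ hm).preimage (A j)
      have hk := ((hagree i k q ⟨hq.1, hq.2.1, hqk⟩) ▸ hm).preimage (A k)
      have e1 := hi.eq_neg_of_disjoint (hdisj i j hij) hj (by simp)
      have e2 := hi.eq_neg_of_disjoint (hdisj i k hki.symm) hk (by simp)
      have e3 := hj.eq_neg_of_disjoint (hdisj j k hkj.symm) hk (by simp)
      rw [e2, e1, neg_neg] at e3
      have h2 : (2 : ℝ) • (A i).linearIsometryEquiv.symm m = 0 := by
        rw [two_smul]; nth_rewrite 1 [← e3]; exact neg_add_cancel _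
      exact hi.1 ((smul_eq_zero.1 h2).resolve_left two_ne_zero)
    have hclosed : IsClosed (⋃ k : {k : ι // k ≠ i ∧ k ≠ j}, closure (A k ⁻¹' Ω₁)) :=
      isClosed_iUnion_of_finite fun _ => isClosed_closure
    have hq' : q ∈ (⋃ k : {k : ι // k ≠ i ∧ k ≠ j}, closure (A k ⁻¹' Ω₁))ᶜ := by
      simp only [mem_compl_iff, mem_iUnion, not_exists]
      exact fun k => h3 k k.2.1 k.2.2
    filter_upwards [hΩ₂.isOpen.mem_nhds hq.1, hclosed.isOpen_compl.mem_nhds hq'] with x hx1 hx2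
    have := hdense hx1
    rw [hcl, mem_iUnion] at this
    obtain ⟨k, hk⟩ := this
    by_cases hki : k = i
    · exact Or.inl (hki ▸ hk)
    by_cases hkj : k = j
    · exact Or.inr (hkj ▸ hk)
    exact absurd (mem_iUnion.2 ⟨⟨k, hki, hkj⟩, hk⟩) hx2
  have hcover : Ω₂ ⊆ closure (A i ⁻¹' Ω₁) := by
    have hclosed : IsClosed (⋃ k : {k : ι // k ≠ i}, closure (A k ⁻¹' Ω₁)) :=
      isClosed_iUnion_of_finite fun _ => isClosed_closure
    have hne : (Ω₂ ∩ closure (A i ⁻¹' Ω₁)).Nonempty := by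
      obtain ⟨x, hx⟩ := hΩ₁.isConnected.nonempty
      have hx' : (A i).symm x ∈ A i ⁻¹' Ω₁ := by simpa using hx
      exact ⟨_, hsub i hx', subset_closure hx'⟩
    intro x hx
    by_contra hxn
    have hcov2 : Ω₂ ⊆ closure (A i ⁻¹' Ω₁) ∪ ⋃ k : {k : ι // k ≠ i}, closure (A k ⁻¹' Ω₁) := by
      intro y hy
      have := hdense hy
      rw [hcl, mem_iUnion] at this
      obtain ⟨k, hk⟩ := this
      by_cases hki : k = i
      · exact Or.inl (hki ▸ hk)
      · exact Or.inr (mem_iUnion.2 ⟨⟨k, hki⟩, hk⟩)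
    -- The closure of tile `i` and the union of the other closures cover the connected set `Ω₂`; if
    -- both met it, they would touch inside it.
    obtain ⟨y, hy, hy1, hy2⟩ := isPreconnected_closed_iff.1 hΩ₂.isConnected.isPreconnected _ _
      isClosed_closure hclosed hcov2 hne ⟨x, hx, (hcov2 hx).resolve_left hxn⟩
    obtain ⟨k, hk⟩ := mem_iUnion.1 hy2
    have : y ∈ Ω₂ ∩ (closure (A i ⁻¹' Ω₁) ∩ closure (A k ⁻¹' Ω₁)) := ⟨hy, hy1, hk⟩
    rw [hempty i k k.2.symm] at this
    exact this
  refine subset_antisymm (hsub i) fun x hx => ?_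
  have h1 : x ∈ interior (closure (A i ⁻¹' Ω₁)) := interior_maximal hcover hΩ₂.isOpen hx
  have e1 : closure (A i ⁻¹' Ω₁) = A i ⁻¹' closure Ω₁ :=
    ((A i).toHomeomorph.preimage_closure Ω₁).symm
  have e2 : interior (A i ⁻¹' closure Ω₁) = A i ⁻¹' interior (closure Ω₁) :=
    ((A i).toHomeomorph.preimage_interior _).symm
  rw [e1, e2, hΩ₁.lipschitz.interior_closure hS] at h1
  exact h1

/-! ### Disjointness preserving functionals -/

/-- A disjointness preserving bounded functional on `C(X)` is a multiple of a point evaluation. -/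
theorem exists_eq_mul_eval {X : Type*} [MetricSpace X] [CompactSpace X] [Nonempty X]
    (l : C(X, ℂ) →L[ℂ] ℂ) (hl : ∀ f g : C(X, ℂ), f * g = 0 → l f * l g = 0) :
    ∃ x, ∀ f, l f = l 1 * f x := by
  -- The largest ideal inside `ker l`. Being closed, it consists of the functions vanishing off
  -- `setOfIdeal I`; the complement of this set plays the role of the support of `l`.
  let I : Ideal C(X, ℂ) :=
    { carrier := {f | ∀ g, l (f * g) = 0}
      add_mem' := fun {a b} ha hb g => by rw [add_mul, map_add, ha g, hb g, add_zero]
      zero_mem' := fun g => by rw [zero_mul, map_zero]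
      smul_mem' := fun c f hf g => by
        have : c • f * g = f * (c * g) := by rw [smul_eq_mul]; ring
        rw [this]; exact hf _ }
  have hI : IsClosed (I : Set C(X, ℂ)) := by
    have : (I : Set C(X, ℂ)) = ⋂ g, {f | l (f * g) = 0} := by ext f; simp [I]
    rw [this]
    exact isClosed_iInter fun g => isClosed_eq (by fun_prop) continuous_const
  have hset := ContinuousMap.idealOfSet_ofIdeal_isClosed hI
  by_cases hex : ∃ x, x ∉ ContinuousMap.setOfIdeal I
  · obtain ⟨x, hx⟩ := hex
    refine ⟨x, fun f => ?_⟩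
    -- Two support points would carry bumps with disjoint supports, and `l` would be nonzero on a
    -- multiple of each.
    have huniq : ∀ y, y ∉ ContinuousMap.setOfIdeal I → y = x := by
      intro y hy
      by_contra hne
      have hr : 0 < dist y x := dist_pos.2 hne
      let bump : X → C(X, ℂ) := fun p =>
        ⟨fun z => ((max 0 (dist y x / 2 - dist z p) : ℝ) : ℂ), by fun_prop⟩
      have hbump : ∀ p z, bump p z ≠ 0 → dist z p < dist y x / 2 := by
        intro p z h
        by_contra! h'
        exact h (by simp [bump, h'])
      have hself : ∀ p, bump p p ≠ 0 := by
        intro p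
        simp only [bump, ContinuousMap.coe_mk, dist_self, sub_zero, ne_eq, Complex.ofReal_eq_zero]
        exact (lt_max_of_lt_right (half_pos hr)).ne'
      have hnot : ∀ p, p ∉ ContinuousMap.setOfIdeal I → ∃ g, l (bump p * g) ≠ 0 := by
        intro p hp
        by_contra! h
        exact ContinuousMap.notMem_setOfIdeal.1 hp (show bump p ∈ I from h) |> hself p
      obtain ⟨g₁, hg₁⟩ := hnot x hx
      obtain ⟨g₂, hg₂⟩ := hnot y hy
      refine mul_ne_zero hg₁ hg₂ (hl _ _ ?_)
      ext z
      simp only [ContinuousMap.mul_apply, ContinuousMap.zero_apply]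
      by_cases h1 : bump x z = 0
      · simp [h1]
      by_cases h2 : bump y z = 0
      · simp [h2]
      have := hbump _ _ h1
      have := hbump _ _ h2
      have := dist_triangle_left y x z
      linarith
    have hmem : f - f x • (1 : C(X, ℂ)) ∈ I := by
      rw [← hset, ContinuousMap.mem_idealOfSet]
      intro y hy
      rw [huniq y hy]
      simp
    have := hmem 1
    rw [mul_one, map_sub, map_smul, sub_eq_zero] at this
    rw [this, smul_eq_mul, mul_comm]
  -- Empty support means `1 ∈ I`, so `l = 0` and any point will do.
  · push Not at hex
    have h1 : (1 : C(X, ℂ)) ∈ I := by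
      rw [← hset, ContinuousMap.mem_idealOfSet]
      exact fun x hx => absurd (hex x) hx
    have h2 : ∀ g, l g = 0 := fun g => by simpa using h1 g
    exact ⟨Classical.arbitrary X, fun f => by rw [h2, h2, zero_mul]⟩

/-! ### Local connectedness and surface measure at the boundary -/

/-- Small neighbourhoods of a boundary point meet a Lipschitz domain inside a connected set. -/
theorem HasLipschitzBoundary.exists_preconnected {Ω : Set (Eucl d)} (hΩ : IsOpen Ω)
    (hL : HasLipschitzBoundary Ω) {q : Eucl d} (hq : q ∈ frontier Ω) {N : Set (Eucl d)}
    (hN : N ∈ 𝓝 q) :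
    ∃ N' ∈ 𝓝 q, N' ⊆ N ∧ ∀ x ∈ N' ∩ Ω, ∀ y ∈ N' ∩ Ω,
      ∃ P, IsPreconnected P ∧ x ∈ P ∧ y ∈ P ∧ P ⊆ N ∩ Ω := by
  obtain ⟨e, γ, K, V, he, hγ, hV, hzV, hiff⟩ := hL q hq
  have hF : Continuous fun x => inner ℝ e x - γ (perp e x) := by
    have := hγ.continuous; have := continuous_perp e; fun_prop
  have h0 := eq_of_mem_frontier hΩ hV hq hzV hF.continuousAt
    (fun x hx => by rw [hiff x hx, sub_pos])
  obtain ⟨r, hr, hball⟩ := Metric.mem_nhds_iff.1 (inter_mem hN (hV.mem_nhds hzV))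
  -- Lifting by `H = (2 K + 1) ε` puts every point of the `ε`-ball above the graph (the 2 is the
  -- factor in `norm_perp_le`), and `ε + H = r / 2` keeps it in the `r`-ball.
  set ε : ℝ := r / (4 + 4 * K) with hε
  have hK : (0 : ℝ) ≤ K := K.2
  have hε0 : 0 < ε := by positivity
  have hεr : ε * (4 + 4 * K) = r := div_mul_cancel₀ _ (by positivity)
  set H : ℝ := (2 * K + 1) * ε with hH
  have hH0 : 0 < H := by positivity
  have key : ∀ u ∈ Metric.ball q ε, ∀ t ∈ Icc 0 H, u + t • e ∈ Metric.ball q r := by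
    intro u hu t ht
    rw [Metric.mem_ball, dist_eq_norm] at hu ⊢
    have h1 := norm_add_le (u - q) (t • e)
    rw [norm_smul, he, Real.norm_of_nonneg ht.1, mul_one] at h1
    rw [show u + t • e - q = u - q + t • e by abel]
    have := ht.2
    nlinarith
  have hvert : ∀ u ∈ Metric.ball q ε ∩ Ω, ∀ t ∈ Icc 0 H, u + t • e ∈ N ∩ Ω := by
    intro u hu t ht
    have h1 := hball (key u hu.1 t ht)
    have h2 := (hiff u (hball (by simpa using key u hu.1 0 ⟨le_rfl, hH0.le⟩)).2).1 hu.2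
    refine ⟨h1.1, (hiff _ h1.2).2 ?_⟩
    rw [perp_add_smul_self he, inner_add_right, inner_smul_right, real_inner_self_eq_norm_sq, he]
    linarith [ht.1]
  have htop : ∀ u ∈ Metric.ball q ε, u + H • e ∈ N ∩ Ω := by
    intro u hu
    have h1 := hball (key u hu H ⟨hH0.le, le_rfl⟩)
    refine ⟨h1.1, (hiff _ h1.2).2 ?_⟩
    rw [perp_add_smul_self he, inner_add_right, inner_smul_right, real_inner_self_eq_norm_sq, he]
    have h2 := hγ.dist_le_mul (perp e u) (perp e q)
    have h3 : perp e u - perp e q = perp e (u - q) := by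
      simp only [perp, inner_sub_right]; module
    rw [Real.dist_eq, dist_eq_norm, h3] at h2
    rw [Metric.mem_ball, dist_eq_norm] at hu
    have h4 := norm_perp_le he (u - q)
    have h5 := norm_inner_le_norm (𝕜 := ℝ) e (u - q)
    rw [he, one_mul, Real.norm_eq_abs, inner_sub_right] at h5
    have h6 := abs_le.1 h5
    have h7 := abs_le.1 h2
    have h8 : (K : ℝ) * ‖perp e (u - q)‖ ≤ K * (2 * ε) :=
      mul_le_mul_of_nonneg_left (by linarith) hK
    nlinarith [h6.1, h7.2]
  refine ⟨Metric.ball q ε, Metric.ball_mem_nhds _ hε0, fun u hu => ?_, fun x hx y hy => ?_⟩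
  · exact (hball (by simpa using key u hu 0 ⟨le_rfl, hH0.le⟩)).1
  have hup : ∀ u ∈ Metric.ball q ε ∩ Ω,
      ∃ P, IsPreconnected P ∧ u ∈ P ∧ u + H • e ∈ P ∧ P ⊆ N ∩ Ω := by
    intro u hu
    refine ⟨(fun t : ℝ => u + t • e) '' Icc 0 H, isPreconnected_Icc.image _ (by fun_prop),
      ⟨0, ⟨le_rfl, hH0.le⟩, by simp⟩, ⟨H, ⟨hH0.le, le_rfl⟩, rfl⟩, ?_⟩
    rintro _ ⟨t, ht, rfl⟩
    exact hvert u hu t ht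
  obtain ⟨P₁, hP₁, h11, h12, h13⟩ := hup x hx
  obtain ⟨P₂, hP₂, h21, h22, h23⟩ := hup y hy
  -- The path goes vertically up from `x`, across the lifted segment, and down to `y`.
  set P₃ := (fun u : Eucl d => u + H • e) '' segment ℝ x y with hP₃d
  have hP₃ : IsPreconnected P₃ := (convex_segment x y).isPreconnected.image _ (by fun_prop)
  have h33 : P₃ ⊆ N ∩ Ω := by
    rintro _ ⟨u, hu, rfl⟩
    exact htop u ((convex_ball q ε).segment_subset hx.1 hy.1 hu)
  refine ⟨P₁ ∪ P₃ ∪ P₂, ?_, Or.inl (Or.inl h11), Or.inr h21,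
    union_subset (union_subset h13 h33) h23⟩
  have hx3 : x + H • e ∈ P₃ := ⟨x, left_mem_segment ℝ x y, rfl⟩
  have hy3 : y + H • e ∈ P₃ := ⟨y, right_mem_segment ℝ x y, rfl⟩
  refine (hP₁.union (x + H • e) h12 hx3 hP₃).union (y + H • e)
    (Or.inr hy3) h22 hP₂

open scoped MeasureTheory in
/-- The surface measure of a Lipschitz set is locally finite at boundary points. -/
theorem HasLipschitzBoundary.exists_surface_lt_top (hd : 1 ≤ d) {Ω : Set (Eucl d)} (hΩ : IsOpen Ω)
    (hL : HasLipschitzBoundary Ω) {q : Eucl d} (hq : q ∈ frontier Ω) :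
    ∃ r > 0, surface Ω (Metric.closedBall q r) < ⊤ := by
  obtain ⟨e, γ, K, V, he, hγ, hV, hzV, hiff⟩ := hL q hq
  have hF : Continuous fun x => inner ℝ e x - γ (perp e x) := by
    have := hγ.continuous; have := continuous_perp e; fun_prop
  obtain ⟨r, hr, hball⟩ := Metric.nhds_basis_closedBall.mem_iff.1 (hV.mem_nhds hzV)
  refine ⟨r, hr, ?_⟩
  have he0 : e ≠ 0 := by rintro rfl; simp at he
  have hfin : Module.finrank ℝ (ℝ ∙ e)ᗮ = d - 1 := by
    have h1 := (ℝ ∙ e).finrank_add_finrank_orthogonal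
    rw [finrank_span_singleton he0, finrank_euclideanSpace_fin] at h1
    omega
  have hperp : ∀ x : Eucl d, perp e x ∈ (ℝ ∙ e)ᗮ := by
    intro x
    rw [Submodule.mem_orthogonal_singleton_iff_inner_right]
    simp [perp, inner_sub_right, inner_smul_right, he]
  -- The boundary is locally the Lipschitz image of a ball in a `(d - 1)`-dimensional space, so its
  -- Hausdorff measure is finite there.
  let g : (ℝ ∙ e)ᗮ → Eucl d := fun y => (y : Eucl d) + γ y • e
  have hg : LipschitzWith (1 + K) g := by
    refine LipschitzWith.add (LipschitzWith.subtype_val _) ?_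
    refine LipschitzWith.of_dist_le_mul fun y y' => ?_
    rw [dist_eq_norm, ← sub_smul, norm_smul, he, mul_one, ← dist_eq_norm]
    exact hγ.dist_le_mul _ _
  set B : Set (ℝ ∙ e)ᗮ := Metric.closedBall ⟨perp e q, hperp q⟩ (2 * r) with hB
  have hsub : frontier Ω ∩ Metric.closedBall q r ⊆ g '' B := by
    rintro x ⟨hxf, hxb⟩
    have h0 := eq_of_mem_frontier hΩ hV hxf (hball hxb) hF.continuousAt
      (fun x hx => by rw [hiff x hx, sub_pos])
    refine ⟨⟨perp e x, hperp x⟩, ?_, ?_⟩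
    · rw [hB, Metric.mem_closedBall, Subtype.dist_eq, dist_eq_norm]
      have h3 : perp e x - perp e q = perp e (x - q) := by
        simp only [perp, inner_sub_right]; module
      rw [h3]
      rw [Metric.mem_closedBall, dist_eq_norm] at hxb
      exact (norm_perp_le he _).trans (by linarith)
    · simp only [g]
      rw [show γ (perp e x) = inner ℝ e x by linarith]
      simp [perp]
  have hBfin : (Measure.hausdorffMeasure ((d - 1 : ℕ) : ℝ) : Measure (ℝ ∙ e)ᗮ) B < ⊤ := by
    rw [← hfin]
    exact (isCompact_closedBall _ _).measure_lt_top
  unfold surface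
  rw [Measure.restrict_apply Metric.isClosed_closedBall.measurableSet, inter_comm]
  refine (measure_mono hsub).trans_lt ?_
  rw [Measure.euclideanHausdorffMeasure_def, Measure.smul_apply]
  refine ENNReal.mul_lt_top ENNReal.coe_lt_top ?_
  refine (hg.hausdorffMeasure_image_le (Nat.cast_nonneg _) B).trans_lt ?_
  exact ENNReal.mul_lt_top (ENNReal.rpow_lt_top_of_nonneg (Nat.cast_nonneg _) ENNReal.coe_ne_top) hBfin

/-! ### Radial mollifiers and Weyl's lemma -/

theorem partialDeriv_congr {f g : Eucl d → ℂ} {x : Eucl d} (h : f =ᶠ[𝓝 x] g) (j : Fin d) :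
    partialDeriv j f x = partialDeriv j g x := by
  unfold partialDeriv; rw [h.fderiv_eq]

theorem laplacian_eq_sum {f : Eucl d → ℂ} {x : Eucl d} (hf : ContDiffAt ℝ 2 f x) :
    Laplacian.laplacian f x = ∑ j, partialDeriv j (partialDeriv j f) x := by
  rw [laplacian_eq_iteratedFDeriv_orthonormalBasis f (EuclideanSpace.basisFun (Fin d) ℝ)]
  refine Finset.sum_congr rfl fun j _ => ?_
  have hd : DifferentiableAt ℝ (fderiv ℝ f) x :=
    (hf.fderiv_right (m := 1) (by norm_num)).differentiableAt one_ne_zero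
  rw [iteratedFDeriv_two_apply]
  unfold partialDeriv
  rw [fderiv_clm_apply hd (by fun_prop)]
  simp

theorem contDiffAt_partialDeriv {f : Eucl d → ℂ} {x : Eucl d} (hf : ContDiffAt ℝ ∞ f x)
    (j : Fin d) : ContDiffAt ℝ ∞ (partialDeriv j f) x :=
  (hf.fderiv_right (m := ∞) (by simp)).clm_apply contDiffAt_const

/-- The profile is a function of the squared norm, so the mollifier `k (‖z‖ ^ 2)` is smooth at the
origin too. -/
theorem exists_radial_profile (d : ℕ) : ∃ k : ℝ → ℝ, ContDiff ℝ ∞ k ∧ (∀ s, 0 ≤ k s) ∧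
    (∀ s, 1 ≤ s → k s = 0) ∧ ∫ z : Eucl d, k (‖z‖ ^ 2) = 1 := by
  let b : ContDiffBump (0 : ℝ) := ⟨1 / 2, 1, by norm_num, by norm_num⟩
  have hb1 : ∀ s : ℝ, 1 ≤ s → b s = 0 := fun s hs =>
    b.zero_of_le_dist (by rw [Real.dist_eq, sub_zero, abs_of_nonneg (by linarith)]; exact hs)
  have hcont : Continuous fun z : Eucl d => b (‖z‖ ^ 2) :=
    b.continuous.comp (continuous_norm.pow 2)
  have hsupp : HasCompactSupport fun z : Eucl d => b (‖z‖ ^ 2) := by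
    refine HasCompactSupport.intro (isCompact_closedBall (0 : Eucl d) 1) fun z hz => hb1 _ ?_
    rw [mem_closedBall_zero_iff, not_le] at hz
    exact one_le_pow₀ hz.le
  have hpos : 0 < ∫ z : Eucl d, b (‖z‖ ^ 2) := by
    refine hcont.integral_pos_of_hasCompactSupport_nonneg_nonzero hsupp (fun z => b.nonneg)
      (x := 0) ?_
    simp [b.one_of_mem_closedBall (x := (0:ℝ)) (by simp [b])]
  refine ⟨fun s => (∫ z : Eucl d, b (‖z‖ ^ 2))⁻¹ * b s, contDiff_const.mul b.contDiff,
    fun s => mul_nonneg (inv_nonneg.2 hpos.le) b.nonneg, fun s hs => by simp [hb1 s hs], ?_⟩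
  rw [integral_const_mul, inv_mul_cancel₀ hpos.ne']

theorem hasFDerivAt_radial {g : ℝ → ℝ} {g' : ℝ} (c : ℝ) (x y : Eucl d)
    (hg : HasDerivAt g g' (c * ‖y - x‖ ^ 2)) :
    HasFDerivAt (fun y : Eucl d => ((g (c * ‖y - x‖ ^ 2) : ℝ) : ℂ))
      (Complex.ofRealCLM.comp (g' • (c • (2 • innerSL ℝ (y - x))))) y := by
  have h1 : HasFDerivAt (fun y : Eucl d => ‖y - x‖ ^ 2) (2 • innerSL ℝ (y - x)) y := by
    have := (hasStrictFDerivAt_norm_sq (y - x)).hasFDerivAt.comp y ((hasFDerivAt_id y).sub_const x)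
    rw [ContinuousLinearMap.comp_id] at this
    exact this
  have h2 := hg.comp_hasFDerivAt y (h1.const_mul c)
  exact Complex.ofRealCLM.hasFDerivAt.comp y h2

theorem partialDeriv_radial {g : ℝ → ℝ} {g' : ℝ} (c : ℝ) (x y : Eucl d)
    (hg : HasDerivAt g g' (c * ‖y - x‖ ^ 2)) (j : Fin d) :
    partialDeriv j (fun y : Eucl d => ((g (c * ‖y - x‖ ^ 2) : ℝ) : ℂ)) y =
      ((g' * (c * (2 * (y j - x j))) : ℝ) : ℂ) := by
  unfold partialDeriv
  rw [(hasFDerivAt_radial c x y hg).fderiv]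
  simp [EuclideanSpace.inner_single_right]

/-- For `c = l ^ 2` the bracket is, up to the factor `l ^ (d - 1)`, the derivative in `l` of `l ^ d
* k (l ^ 2 * ‖y - x‖ ^ 2)`. Changing the scale of a radial mollifier thus adds a Laplacian, which is
the mechanism behind Weyl's lemma. -/
theorem laplacian_radial {K k k' : ℝ → ℝ} (hK : ∀ s, HasDerivAt K (k s) s)
    (hk : ∀ s, HasDerivAt k (k' s) s) (hk' : Continuous k') (c : ℝ) (x y : Eucl d) :
    Laplacian.laplacian (fun y : Eucl d => ((K (c * ‖y - x‖ ^ 2) : ℝ) : ℂ)) y =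
      ((2 * c * (d * k (c * ‖y - x‖ ^ 2)
        + 2 * (c * ‖y - x‖ ^ 2) * k' (c * ‖y - x‖ ^ 2)) : ℝ) : ℂ) := by
  have hKd : deriv K = k := funext fun s => (hK s).deriv
  have hkd : deriv k = k' := funext fun s => (hk s).deriv
  have hkC : ContDiff ℝ 1 k :=
    contDiff_one_iff_deriv.2 ⟨fun s => (hk s).differentiableAt, by rwa [hkd]⟩
  have hKC : ContDiff ℝ 2 K := by
    rw [show (2 : WithTop ℕ∞) = 1 + 1 by norm_num, contDiff_succ_iff_deriv]
    exact ⟨fun s => (hK s).differentiableAt, by simp, by rwa [hKd]⟩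
  have hC : ContDiff ℝ 2 (fun y : Eucl d => ((K (c * ‖y - x‖ ^ 2) : ℝ) : ℂ)) := by
    refine Complex.ofRealCLM.contDiff.comp (hKC.comp (contDiff_const.mul ?_))
    exact (contDiff_id.sub contDiff_const).norm_sq ℝ
  rw [laplacian_eq_sum hC.contDiffAt]
  have h1 : ∀ j, partialDeriv j (fun y : Eucl d => ((K (c * ‖y - x‖ ^ 2) : ℝ) : ℂ)) =
      fun y => ((k (c * ‖y - x‖ ^ 2) : ℝ) : ℂ) * ((2 * c * (y j - x j) : ℝ) : ℂ) := by
    intro j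
    funext y
    rw [partialDeriv_radial c x y (hK _) j]
    push_cast; ring
  have h2 : ∀ j, partialDeriv j (partialDeriv j
      (fun y : Eucl d => ((K (c * ‖y - x‖ ^ 2) : ℝ) : ℂ))) y =
      ((2 * c * (k (c * ‖y - x‖ ^ 2) + 2 * c * k' (c * ‖y - x‖ ^ 2) * (y j - x j) ^ 2) : ℝ) : ℂ) := by
    intro j
    rw [h1]
    have e1 := hasFDerivAt_radial c x y (hk _)
    have e2 : HasFDerivAt (fun y : Eucl d => ((2 * c * (y j - x j) : ℝ) : ℂ))
        (Complex.ofRealCLM.comp ((2 * c) • EuclideanSpace.proj (𝕜 := ℝ) j)) y := by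
      refine Complex.ofRealCLM.hasFDerivAt.comp y ?_
      exact (((EuclideanSpace.proj (𝕜 := ℝ) j).hasFDerivAt).sub_const (x j)).const_mul (2 * c)
    have e3 := e1.fun_mul e2
    unfold partialDeriv
    rw [e3.fderiv]
    simp [EuclideanSpace.inner_single_right]
    ring
  rw [Finset.sum_congr rfl fun j _ => h2 j, ← Complex.ofReal_sum]
  congr 1
  rw [← Finset.mul_sum, Finset.sum_add_distrib, ← Finset.mul_sum, EuclideanSpace.norm_sq_eq]
  simp only [Finset.sum_const, Finset.card_univ, Fintype.card_fin, nsmul_eq_mul, PiLp.sub_apply,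
    Real.norm_eq_abs, sq_abs]
  ring

/-- If an integrable function annihilates the Laplacians of all radial test functions supported in
the closed ball of radius `1 / a` around a continuity point, its average with respect to the radial
mollifier of this radius is its value. -/
theorem integral_mollifier_eq (hd : 1 ≤ d) {k : ℝ → ℝ} (hk : ContDiff ℝ ∞ k) (hk0 : ∀ s, 0 ≤ k s)
    (hk1 : ∀ s, 1 ≤ s → k s = 0) (hint : ∫ z : Eucl d, k (‖z‖ ^ 2) = 1) {v : Eucl d → ℂ}
    (hv : Integrable v) {x : Eucl d} (hvx : ContinuousAt v x) {a : ℝ} (ha : 0 < a)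
    (h : ∀ φ : Eucl d → ℂ, ContDiff ℝ ∞ φ → (∀ y ∉ Metric.closedBall x a⁻¹, φ y = 0) →
      ∫ y, v y * Laplacian.laplacian φ y = 0) :
    ∫ y, (a ^ d * k (‖a • (x - y)‖ ^ 2)) • v y = v x := by
  have hkd : ContDiff ℝ ∞ (deriv k) := (contDiff_infty_iff_deriv.1 hk).2
  have hkD : ∀ s, HasDerivAt k (deriv k s) s := fun s =>
    (hk.differentiable (by simp) s).hasDerivAt
  set κ : ℝ → ℝ := fun s => d * k s + 2 * s * deriv k s with hκ
  have hκc : Continuous κ := by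
    have := hk.continuous; have := hkd.continuous; fun_prop
  have hk'1 : ∀ s, 1 < s → deriv k s = 0 := by
    intro s hs
    have : k =ᶠ[𝓝 s] fun _ => 0 := by
      filter_upwards [lt_mem_nhds hs] with t ht using hk1 t ht.le
    rw [this.deriv_eq]; simp
  have hκ1 : ∀ s, 1 < s → κ s = 0 := fun s hs => by simp [hκ, hk1 s hs.le, hk'1 s hs]
  obtain ⟨B, hB⟩ : ∃ B, ∀ s, 0 ≤ s → |κ s| ≤ B := by
    obtain ⟨B, hB⟩ := (isCompact_Icc (a := (0 : ℝ)) (b := 1)).exists_bound_of_continuousOn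
      hκc.continuousOn
    refine ⟨B, fun s hs => ?_⟩
    by_cases h1 : s ≤ 1
    · exact hB s ⟨hs, h1⟩
    · rw [hκ1 s (not_le.1 h1), abs_zero]
      exact (norm_nonneg _).trans (hB 0 ⟨le_rfl, zero_le_one⟩)
  obtain ⟨Bk, hBk⟩ : ∃ B, ∀ s, 0 ≤ s → ‖k s‖ ≤ B := by
    obtain ⟨B, hB⟩ := (isCompact_Icc (a := (0 : ℝ)) (b := 1)).exists_bound_of_continuousOn
      hk.continuous.continuousOn
    refine ⟨B, fun s hs => ?_⟩
    by_cases h1 : s ≤ 1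
    · exact hB s ⟨hs, h1⟩
    · rw [hk1 s (not_le.1 h1).le, norm_zero]
      exact (norm_nonneg _).trans (hB 0 ⟨le_rfl, zero_le_one⟩)
  -- Starting the primitive at 1 makes it vanish on `[1, ∞)`, so the radial function built from it
  -- has compact support.
  set K : ℝ → ℝ := fun s => ∫ t in (1 : ℝ)..s, k t with hKdef
  have hKD : ∀ s, HasDerivAt K (k s) s := fun s =>
    intervalIntegral.integral_hasDerivAt_right (hk.continuous.intervalIntegrable _ _)
      (hk.continuous.stronglyMeasurableAtFilter _ _) hk.continuous.continuousAt
  have hK1 : ∀ s, 1 ≤ s → K s = 0 := by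
    intro s hs
    refine (intervalIntegral.integral_congr (g := fun _ => 0) fun t ht => ?_).trans (by simp)
    rw [uIcc_of_le hs] at ht
    exact hk1 t ht.1
  have hKC : ContDiff ℝ ∞ K :=
    contDiff_infty_iff_deriv.2 ⟨fun s => (hKD s).differentiableAt, by
      rwa [show deriv K = k from funext fun s => (hKD s).deriv]⟩
  have hnorm : ∀ (l : ℝ) (y : Eucl d), ‖l • (x - y)‖ ^ 2 = l ^ 2 * ‖y - x‖ ^ 2 := fun l y => by
    rw [norm_smul, mul_pow, Real.norm_eq_abs, sq_abs, norm_sub_rev]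
  -- The average of `v` around `x` at scale `1 / l`. Its derivative in `l` is an integral of `v`
  -- against a Laplacian, so `E` is constant on `[a, ∞)`, while it tends to `v x` as `l → ∞`.
  set E : ℝ → ℂ := fun l => ∫ y, (l ^ d * k (‖l • (x - y)‖ ^ 2)) • v y with hE
  have hmeas : ∀ f : Eucl d → ℝ, Continuous f → AEStronglyMeasurable (fun y => f y • v y) :=
    fun f hf => hf.aestronglyMeasurable.smul hv.aestronglyMeasurable
  have hzero : ∀ l, a ≤ l → ∫ y, (l ^ (d - 1) * κ (l ^ 2 * ‖y - x‖ ^ 2)) • v y = 0 := by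
    intro l hl
    have hl0 : 0 < l := ha.trans_le hl
    have h1 := h (fun y => ((K (l ^ 2 * ‖y - x‖ ^ 2) : ℝ) : ℂ)) ?_ ?_
    · have h2 : ∀ y, (l ^ (d - 1) * κ (l ^ 2 * ‖y - x‖ ^ 2)) • v y =
          ((l ^ (d - 1) / (2 * l ^ 2) : ℝ) : ℂ) * (v y * Laplacian.laplacian
            (fun y => ((K (l ^ 2 * ‖y - x‖ ^ 2) : ℝ) : ℂ)) y) := by
        intro y
        rw [laplacian_radial hKD hkD hkd.continuous, Complex.real_smul]
        have : (l : ℂ) ≠ 0 := by exact_mod_cast hl0.ne'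
        simp only [hκ]
        push_cast
        field_simp
      simp_rw [h2]
      rw [integral_const_mul, h1, mul_zero]
    · refine Complex.ofRealCLM.contDiff.comp (hKC.comp (contDiff_const.mul ?_))
      exact (contDiff_id.sub contDiff_const).norm_sq ℝ
    · intro y hy
      rw [Metric.mem_closedBall, dist_eq_norm, not_le, inv_lt_iff_one_lt_mul₀ ha] at hy
      rw [hK1, Complex.ofReal_zero]
      rw [← mul_pow]
      refine one_le_pow₀ (hy.le.trans ?_)
      rw [mul_comm]
      exact mul_le_mul_of_nonneg_right hl (norm_nonneg _)
  have hderiv : ∀ l, a ≤ l → HasDerivAt E 0 l := by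
    intro l hl
    have hl0 : 0 < l := ha.trans_le hl
    rw [← hzero l hl]
    refine (hasDerivAt_integral_of_dominated_loc_of_deriv_le (s := Ioo 0 (l + 1))
      (F' := fun l y => (l ^ (d - 1) * κ (l ^ 2 * ‖y - x‖ ^ 2)) • v y)
      (bound := fun y => ((l + 1) ^ (d - 1) * B) * ‖v y‖)
      (Ioo_mem_nhds hl0 (by linarith)) (Eventually.of_forall fun t => hmeas _ ?_) ?_ (hmeas _ ?_)
      (ae_of_all _ fun y t ht => ?_) (hv.norm.const_mul _)
      (ae_of_all _ fun y t ht => ?_)).2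
    · have := hk.continuous; fun_prop
    · have hc : Continuous fun y : Eucl d => l ^ d * k (‖l • (x - y)‖ ^ 2) := by
        have := hk.continuous; fun_prop
      have hb : ∀ y : Eucl d, ‖l ^ d * k (‖l • (x - y)‖ ^ 2)‖ ≤ l ^ d * Bk := fun y => by
        rw [norm_mul, Real.norm_of_nonneg (pow_nonneg hl0.le _)]
        exact mul_le_mul_of_nonneg_left (hBk _ (by positivity)) (by positivity)
      exact hv.bdd_smul (l ^ d * Bk) hc.aestronglyMeasurable (ae_of_all _ hb)
    · fun_prop
    · rw [norm_smul]
      refine mul_le_mul_of_nonneg_right ?_ (norm_nonneg _)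
      rw [norm_mul, Real.norm_of_nonneg (pow_nonneg ht.1.le _), Real.norm_eq_abs]
      exact mul_le_mul (pow_le_pow_left₀ ht.1.le ht.2.le _) (hB _ (by positivity)) (abs_nonneg _)
        (by positivity)
    · simp_rw [hnorm]
      refine HasDerivAt.smul_const ?_ (v y)
      have e1 := (hasDerivAt_pow d t).mul
        ((hkD (t ^ 2 * ‖y - x‖ ^ 2)).comp t ((hasDerivAt_pow 2 t).mul_const (‖y - x‖ ^ 2)))
      convert! e1 using 1
      obtain ⟨m, rfl⟩ : ∃ m, d = m + 1 := ⟨d - 1, by omega⟩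
      simp only [hκ, Nat.add_sub_cancel, pow_succ, Function.comp]
      push_cast
      ring
  have hconst : ∀ l, a ≤ l → E l = E a := by
    intro l hl
    refine constant_of_has_deriv_right_zero (a := a) (b := l)
      (fun t ht => (hderiv t ht.1).continuousAt.continuousWithinAt)
      (fun t ht => (hderiv t ht.1).hasDerivWithinAt) l ⟨hl, le_rfl⟩
  have hlim : Tendsto E atTop (𝓝 (v x)) := by
    have := tendsto_integral_comp_smul_smul_of_integrable' (μ := (volume : Measure (Eucl d)))
      (φ := fun z => k (‖z‖ ^ 2)) (fun z => hk0 _) hint ?_ hv hvx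
    · rw [finrank_euclideanSpace_fin] at this; exact this
    · refine tendsto_const_nhds.congr' ?_
      have : ∀ᶠ z : Eucl d in Bornology.cobounded (Eucl d), 1 ≤ ‖z‖ :=
        tendsto_norm_cobounded_atTop.eventually_ge_atTop 1
      filter_upwards [this] with z hz
      rw [hk1 _ (one_le_pow₀ hz), mul_zero]
  exact tendsto_nhds_unique (tendsto_const_nhds.congr' (by
    filter_upwards [eventually_ge_atTop a] with l hl using (hconst l hl).symm)) hlim

theorem laplacian_eq_zero_of_notMem {φ : Eucl d → ℂ} {y : Eucl d} (hy : y ∉ tsupport φ) :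
    Laplacian.laplacian φ y = 0 := by
  have : φ =ᶠ[𝓝 y] fun _ => 0 := notMem_tsupport_iff_eventuallyEq.1 hy
  rw [laplacian_congr_nhds this |>.eq_of_nhds]
  simp

/-- **Weyl's lemma** for continuous functions. -/
theorem contDiffOn_of_distrib_harmonic (hd : 1 ≤ d) {G : Set (Eucl d)} (hG : IsOpen G)
    {u : Eucl d → ℂ} (hu : ContinuousOn u G)
    (h : ∀ φ, IsTestFunction G φ → ∫ y, u y * Laplacian.laplacian φ y = 0) :
    ContDiffOn ℝ ∞ u G := by
  intro x₀ hx₀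
  obtain ⟨R, hR, hball⟩ := Metric.nhds_basis_closedBall.mem_iff.1 (hG.mem_nhds hx₀)
  obtain ⟨k, hk, hk0, hk1, hint⟩ := exists_radial_profile d
  set r := R / 2 with hr
  have hr0 : 0 < r := half_pos hR
  set v : Eucl d → ℂ := (Metric.closedBall x₀ R).indicator u with hv
  have hvint : Integrable v := by
    rw [hv, integrable_indicator_iff Metric.isClosed_closedBall.measurableSet]
    exact (hu.mono hball).integrableOn_compact (isCompact_closedBall _ _)
  have hvu : ∀ x ∈ Metric.ball x₀ R, v =ᶠ[𝓝 x] u := fun x hx => by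
    filter_upwards [Metric.isOpen_ball.mem_nhds hx] with y hy
    exact indicator_of_mem (Metric.ball_subset_closedBall hy) _
  set g : Eucl d → ℝ := fun z => ((r⁻¹) ^ d * k (‖r⁻¹ • z‖ ^ 2)) with hg
  -- With `r = R / 2`, balls of radius `r` around such `x` stay where `v = u`. Near `x₀` the
  -- function `u` is then a convolution with a fixed smooth kernel.
  have hrep : ∀ x ∈ Metric.ball x₀ r, ∫ y, g (x - y) • v y = u x := by
    intro x hx
    have hxR : x ∈ Metric.ball x₀ R := Metric.ball_subset_ball (by linarith) hx
    rw [← (hvu x hxR).eq_of_nhds]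
    refine integral_mollifier_eq hd hk hk0 hk1 hint hvint ?_ (inv_pos.2 hr0) ?_
    · exact ((hu.continuousAt (hG.mem_nhds (hball (Metric.ball_subset_closedBall hxR)))).congr
        (hvu x hxR).symm)
    · intro φ hφ hφ0
      rw [inv_inv] at hφ0
      have hts : tsupport φ ⊆ Metric.closedBall x r := by
        refine closure_minimal (fun y hy => ?_) Metric.isClosed_closedBall
        by_contra hc
        exact hy (hφ0 y hc)
      have hsub : Metric.closedBall x r ⊆ Metric.closedBall x₀ R :=
        Metric.closedBall_subset_closedBall' (by rw [Metric.mem_ball] at hx; linarith)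
      rw [← h φ ⟨hφ, HasCompactSupport.of_support_subset_isCompact (isCompact_closedBall x r)
        (subset_closure.trans hts), hts.trans (hsub.trans hball)⟩]
      refine integral_congr_ae (ae_of_all _ fun y => ?_)
      by_cases hy : y ∈ tsupport φ
      · simp only [hv, indicator_of_mem (hsub (hts hy))]
      · simp only [laplacian_eq_zero_of_notMem hy, mul_zero]
  have hconv : ContDiff ℝ ∞ (convolution v g (ContinuousLinearMap.lsmul ℝ ℝ).flip volume) := by
    refine HasCompactSupport.contDiff_convolution_right _ ?_ hvint.locallyIntegrable ?_
    · refine HasCompactSupport.intro (isCompact_closedBall (0 : Eucl d) r) fun z hz => ?_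
      rw [mem_closedBall_zero_iff, not_le] at hz
      rw [hg]
      simp only
      rw [hk1, mul_zero]
      refine one_le_pow₀ ?_
      rw [norm_smul, Real.norm_of_nonneg (inv_nonneg.2 hr0.le)]
      rw [inv_mul_eq_div, one_le_div hr0]
      exact hz.le
    · have h1 : ContDiff ℝ ∞ fun z : Eucl d => r⁻¹ • z := contDiff_const_smul _
      have h2 : ContDiff ℝ ∞ fun z : Eucl d => ‖r⁻¹ • z‖ ^ 2 := h1.norm_sq ℝ
      exact contDiff_const.mul (hk.comp h2)
  refine (hconv.contDiffAt.congr_of_eventuallyEq ?_).contDiffWithinAt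
  filter_upwards [Metric.ball_mem_nhds x₀ hr0] with x hx
  rw [← hrep x hx]
  rfl

/-! ### Integration by parts and distributional Laplacians -/

/-- Nothing is known about `f` off `G`, but `g` vanishes near every point outside its support, so
integrals over the whole space make sense. -/
theorem continuous_mul_of_tsupport_subset {G : Set (Eucl d)} (hG : IsOpen G) {f g : Eucl d → ℂ}
    (hf : ContinuousOn f G) (hg : ContinuousOn g G) (hgs : tsupport g ⊆ G) :
    Continuous fun x => f x * g x := by
  refine continuous_iff_continuousAt.2 fun x => ?_
  by_cases hx : x ∈ tsupport g
  · exact (hf.continuousAt (hG.mem_nhds (hgs hx))).mul (hg.continuousAt (hG.mem_nhds (hgs hx)))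
  · refine (continuousAt_const (y := (0 : ℂ))).congr ?_
    filter_upwards [notMem_tsupport_iff_eventuallyEq.1 hx] with y hy
    rw [hy]; simp

theorem integrable_mul_of_tsupport_subset {G : Set (Eucl d)} (hG : IsOpen G) {f g : Eucl d → ℂ}
    (hf : ContinuousOn f G) (hg : ContinuousOn g G) (hgc : HasCompactSupport g)
    (hgs : tsupport g ⊆ G) : Integrable fun x => f x * g x :=
  (continuous_mul_of_tsupport_subset hG hf hg hgs).integrable_of_hasCompactSupport hgc.mul_left

theorem IsTestFunction.pderiv {Ω : Set (Eucl d)} {φ : Eucl d → ℂ}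
    (h : IsTestFunction Ω φ) (j : Fin d) : IsTestFunction Ω (partialDeriv j φ) where
  smooth := contDiff_iff_contDiffAt.2 fun _ => contDiffAt_partialDeriv h.smooth.contDiffAt j
  compact := h.compact.fderiv_apply ℝ _
  support := (tsupport_fderiv_apply_subset ℝ _).trans h.support

theorem ContDiffOn.partialDeriv {G : Set (Eucl d)} (hG : IsOpen G) {u : Eucl d → ℂ}
    (hu : ContDiffOn ℝ ∞ u G) (j : Fin d) : ContDiffOn ℝ ∞ (partialDeriv j u) G := fun _ hx =>
  (contDiffAt_partialDeriv (hu.contDiffAt (hG.mem_nhds hx)) j).contDiffWithinAt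

theorem integral_mul_partialDeriv {G : Set (Eucl d)} (hG : IsOpen G) {u φ : Eucl d → ℂ}
    (hu : ContDiffOn ℝ ∞ u G) (hφ : IsTestFunction G φ) (j : Fin d) :
    ∫ x, u x * partialDeriv j φ x = - ∫ x, partialDeriv j u x * φ x := by
  have hφj := hφ.pderiv j
  refine integral_mul_fderiv_eq_neg_fderiv_mul_of_integrable ?_ ?_ ?_ (fun x hx => ?_)
    (fun x hx => hφ.smooth.differentiable (by simp) x)
  · exact integrable_mul_of_tsupport_subset hG (ContDiffOn.partialDeriv hG hu j).continuousOn
      hφ.smooth.continuous.continuousOn hφ.compact hφ.support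
  · exact integrable_mul_of_tsupport_subset hG hu.continuousOn
      hφj.smooth.continuous.continuousOn hφj.compact hφj.support
  · exact integrable_mul_of_tsupport_subset hG hu.continuousOn
      hφ.smooth.continuous.continuousOn hφ.compact hφ.support
  · exact (hu.contDiffAt (hG.mem_nhds (hφ.support hx))).differentiableAt (by simp)

/-- The fundamental lemma of the calculus of variations; real test functions, viewed as complex
ones, already separate. -/
theorem eqOn_of_integral_mul_eq {G : Set (Eucl d)} (hG : IsOpen G) {f g : Eucl d → ℂ}
    (hf : LocallyIntegrableOn f G) (hg : LocallyIntegrableOn g G)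
    (h : ∀ φ, IsTestFunction G φ → ∫ x, f x * φ x = ∫ x, g x * φ x) :
    ∀ᵐ x, x ∈ G → f x = g x := by
  have := hG.ae_eq_zero_of_integral_contDiff_smul_eq_zero (μ := volume) (hf.sub hg) ?_
  · filter_upwards [this] with x hx hxG using sub_eq_zero.1 (hx hxG)
  intro φ hφ hφc hφs
  have hcs : tsupport (fun x => (φ x : ℂ)) = tsupport φ := by
    unfold tsupport; congr 1; ext x; simp
  have ht : IsTestFunction G (fun x => (φ x : ℂ)) :=
    ⟨Complex.ofRealCLM.contDiff.comp hφ, by rw [HasCompactSupport, hcs]; exact hφc, by rwa [hcs]⟩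
  have hint : ∀ f : Eucl d → ℂ, LocallyIntegrableOn f G → Integrable fun x => f x * (φ x : ℂ) := by
    intro f hf
    have h1 : IntegrableOn f (tsupport φ) := hf.integrableOn_compact_subset hφs hφc
    have h2 : IntegrableOn (fun x => f x * (φ x : ℂ)) (tsupport φ) :=
      h1.mul_continuousOn_of_subset (ht.smooth.continuous.continuousOn)
        (isClosed_tsupport _).measurableSet hφc subset_rfl
    rw [← integrableOn_iff_integrable_of_support_subset (s := tsupport φ)]
    · exact h2
    · intro x hx
      refine subset_tsupport _ fun h0 => hx ?_
      simp [h0]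
  have h3 : ∀ x, φ x • (f - g) x = f x * (φ x : ℂ) - g x * (φ x : ℂ) := fun x => by
    rw [Complex.real_smul, Pi.sub_apply]; ring
  simp_rw [h3]
  rw [integral_sub (hint f hf) (hint g hg), h _ ht, sub_self]

theorem integral_mul_laplacian {G : Set (Eucl d)} (hG : IsOpen G) {u φ : Eucl d → ℂ}
    (hu : ContDiffOn ℝ ∞ u G) (hφ : IsTestFunction G φ) :
    ∫ x, u x * Laplacian.laplacian φ x =
      ∫ x, (∑ j, partialDeriv j (partialDeriv j u) x) * φ x := by
  have e1 : ∀ x, u x * Laplacian.laplacian φ x =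
      ∑ j, u x * partialDeriv j (partialDeriv j φ) x := fun x => by
    rw [laplacian_eq_sum ((contDiff_infty.1 hφ.smooth 2).contDiffAt), Finset.mul_sum]
  simp_rw [e1, Finset.sum_mul]
  rw [integral_finsetSum, integral_finsetSum]
  · refine Finset.sum_congr rfl fun j _ => ?_
    rw [integral_mul_partialDeriv hG hu (hφ.pderiv j),
      integral_mul_partialDeriv hG (ContDiffOn.partialDeriv hG hu j) hφ, neg_neg]
  · intro j _
    exact integrable_mul_of_tsupport_subset hG
      (ContDiffOn.partialDeriv hG (ContDiffOn.partialDeriv hG hu j) j).continuousOn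
      hφ.smooth.continuous.continuousOn hφ.compact hφ.support
  · intro j _
    have := (hφ.pderiv j).pderiv j
    exact integrable_mul_of_tsupport_subset hG hu.continuousOn
      this.smooth.continuous.continuousOn this.compact this.support

/-- For smooth functions the distributional Laplacian is the classical one. -/
theorem laplacian_eq_of_distrib {G : Set (Eucl d)} (hG : IsOpen G) {u w : Eucl d → ℂ}
    (hu : ContDiffOn ℝ ∞ u G) (hw : ContinuousOn w G)
    (h : ∀ φ, IsTestFunction G φ → ∫ x, u x * Laplacian.laplacian φ x = ∫ x, w x * φ x) :
    ∀ x ∈ G, ∑ j, partialDeriv j (partialDeriv j u) x = w x := by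
  have h2 : ∀ j, ContDiffOn ℝ ∞ (partialDeriv j (partialDeriv j u)) G := fun j =>
    ContDiffOn.partialDeriv hG (ContDiffOn.partialDeriv hG hu j) j
  have hc : ContinuousOn (fun x => ∑ j, partialDeriv j (partialDeriv j u) x) G :=
    continuousOn_finsetSum _ fun j _ => (h2 j).continuousOn
  have hae := eqOn_of_integral_mul_eq hG (hc.locallyIntegrableOn hG.measurableSet)
    (hw.locallyIntegrableOn hG.measurableSet) (fun φ hφ => ?_)
  · exact Measure.eqOn_open_of_ae_eq (μ := volume) ((ae_restrict_iff' hG.measurableSet).2 hae)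
      hG hc hw
  · rw [← h φ hφ]
    exact (integral_mul_laplacian hG hu hφ).symm

/-! ### Rigidity of weighted compositions intertwining the Laplacian -/

theorem partialDeriv_mul {f g : Eucl d → ℂ} {x : Eucl d} (hf : DifferentiableAt ℝ f x)
    (hg : DifferentiableAt ℝ g x) (j : Fin d) :
    partialDeriv j (fun y => f y * g y) x = f x * partialDeriv j g x + partialDeriv j f x * g x := by
  unfold partialDeriv
  rw [fderiv_fun_mul hf hg]
  simp [mul_comm]

theorem partialDeriv_add {f g : Eucl d → ℂ} {x : Eucl d} (hf : DifferentiableAt ℝ f x)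
    (hg : DifferentiableAt ℝ g x) (j : Fin d) :
    partialDeriv j (fun y => f y + g y) x = partialDeriv j f x + partialDeriv j g x := by
  unfold partialDeriv
  rw [fderiv_fun_add hf hg]; simp

theorem partialDeriv_sum {ι : Type*} (s : Finset ι) {f : ι → Eucl d → ℂ} {x : Eucl d}
    (hf : ∀ i ∈ s, DifferentiableAt ℝ (f i) x) (j : Fin d) :
    partialDeriv j (fun y => ∑ i ∈ s, f i y) x = ∑ i ∈ s, partialDeriv j (f i) x := by
  unfold partialDeriv
  rw [fderiv_fun_sum hf, sum_apply]

theorem partialDeriv_const (c : ℂ) (x : Eucl d) (j : Fin d) :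
    partialDeriv j (fun _ => c) x = 0 := by
  simp [partialDeriv]

theorem partialDeriv_coord (i j : Fin d) (x : Eucl d) :
    partialDeriv j (fun y : Eucl d => ((y i : ℝ) : ℂ)) x = if i = j then 1 else 0 := by
  unfold partialDeriv
  have : HasFDerivAt (fun y : Eucl d => ((y i : ℝ) : ℂ))
      (Complex.ofRealCLM.comp (EuclideanSpace.proj (𝕜 := ℝ) i)) x :=
    Complex.ofRealCLM.hasFDerivAt.comp x (EuclideanSpace.proj (𝕜 := ℝ) i).hasFDerivAt
  rw [this.fderiv]
  by_cases h : i = j <;> simp [h]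

theorem contDiff_coord (i : Fin d) : ContDiff ℝ ∞ (fun y : Eucl d => ((y i : ℝ) : ℂ)) :=
  Complex.ofRealCLM.contDiff.comp (EuclideanSpace.proj (𝕜 := ℝ) i).contDiff

theorem partialDeriv_comm {f : Eucl d → ℂ} {x : Eucl d} (hf : ContDiffAt ℝ ∞ f x) (j k : Fin d) :
    partialDeriv j (partialDeriv k f) x = partialDeriv k (partialDeriv j f) x := by
  have h2 : ContDiffAt ℝ 2 f x := contDiffAt_infty.1 hf 2
  have hd : DifferentiableAt ℝ (fderiv ℝ f) x :=
    (h2.fderiv_right (m := 1) (by norm_num)).differentiableAt one_ne_zero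
  have hs := h2.isSymmSndFDerivAt (by simp)
  unfold partialDeriv
  rw [fderiv_clm_apply hd (by fun_prop), fderiv_clm_apply hd (by fun_prop)]
  simpa using hs _ _

theorem fderiv_eq_zero_of_partialDeriv {f : Eucl d → ℂ} {x : Eucl d}
    (h : ∀ j, partialDeriv j f x = 0) : fderiv ℝ f x = 0 := by
  refine ContinuousLinearMap.coe_injective ((EuclideanSpace.basisFun (Fin d) ℝ).toBasis.ext fun j => ?_)
  simpa [partialDeriv] using h j

/-- The coordinate Laplacian. -/
noncomputable def coordLaplacian (f : Eucl d → ℂ) (x : Eucl d) : ℂ :=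
  ∑ k, partialDeriv k (partialDeriv k f) x

/-- The bilinear carré du champ `∇f · ∇g`. -/
noncomputable def gradDot (f g : Eucl d → ℂ) (x : Eucl d) : ℂ :=
  ∑ k, partialDeriv k f x * partialDeriv k g x

theorem coordLaplacian_mul {G : Set (Eucl d)} (hG : IsOpen G) {f g : Eucl d → ℂ}
    (hf : ContDiffOn ℝ ∞ f G) (hg : ContDiffOn ℝ ∞ g G) {x : Eucl d} (hx : x ∈ G) :
    coordLaplacian (fun y => f y * g y) x =
      f x * coordLaplacian g x + 2 * gradDot f g x + coordLaplacian f x * g x := by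
  have hfa : ∀ y ∈ G, ContDiffAt ℝ ∞ f y := fun y hy => hf.contDiffAt (hG.mem_nhds hy)
  have hga : ∀ y ∈ G, ContDiffAt ℝ ∞ g y := fun y hy => hg.contDiffAt (hG.mem_nhds hy)
  have hdiff : ∀ {f : Eucl d → ℂ} {y : Eucl d}, ContDiffAt ℝ ∞ f y → DifferentiableAt ℝ f y :=
    fun h => h.differentiableAt (by simp)
  unfold coordLaplacian gradDot
  rw [Finset.mul_sum, Finset.mul_sum, Finset.sum_mul, ← Finset.sum_add_distrib,
    ← Finset.sum_add_distrib]
  refine Finset.sum_congr rfl fun k _ => ?_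
  have h1 : partialDeriv k (fun y => f y * g y) =ᶠ[𝓝 x]
      fun y => f y * partialDeriv k g y + partialDeriv k f y * g y := by
    filter_upwards [hG.mem_nhds hx] with y hy
    exact partialDeriv_mul (hdiff (hfa y hy)) (hdiff (hga y hy)) k
  have df := hdiff (hfa x hx)
  have dg := hdiff (hga x hx)
  have dfk := hdiff (contDiffAt_partialDeriv (hfa x hx) k)
  have dgk := hdiff (contDiffAt_partialDeriv (hga x hx) k)
  rw [partialDeriv_congr h1, partialDeriv_add (df.fun_mul dgk) (dfk.fun_mul dg), partialDeriv_mul df dgk,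
    partialDeriv_mul dfk dg]
  ring

theorem gradDot_mul_left {f₁ f₂ g : Eucl d → ℂ} {x : Eucl d} (h₁ : DifferentiableAt ℝ f₁ x)
    (h₂ : DifferentiableAt ℝ f₂ x) :
    gradDot (fun y => f₁ y * f₂ y) g x = f₁ x * gradDot f₂ g x + f₂ x * gradDot f₁ g x := by
  unfold gradDot
  rw [Finset.mul_sum, Finset.mul_sum, ← Finset.sum_add_distrib]
  refine Finset.sum_congr rfl fun k _ => ?_
  rw [partialDeriv_mul h₁ h₂]; ring

theorem coordLaplacian_coord (i : Fin d) (x : Eucl d) :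
    coordLaplacian (fun y : Eucl d => ((y i : ℝ) : ℂ)) x = 0 := by
  refine Finset.sum_eq_zero fun k _ => ?_
  have : partialDeriv k (fun y : Eucl d => ((y i : ℝ) : ℂ)) = fun _ => if i = k then 1 else 0 :=
    funext fun y => partialDeriv_coord i k y
  rw [this, partialDeriv_const]

theorem coordLaplacian_coord_mul (i j : Fin d) (x : Eucl d) :
    coordLaplacian (fun y : Eucl d => ((y i : ℝ) : ℂ) * ((y j : ℝ) : ℂ)) x =
      if i = j then 2 else 0 := by
  rw [coordLaplacian_mul isOpen_univ (contDiff_coord i).contDiffOn (contDiff_coord j).contDiffOn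
    (mem_univ x), coordLaplacian_coord, coordLaplacian_coord]
  unfold gradDot
  simp only [partialDeriv_coord]
  by_cases h : i = j
  · subst h; simp
  · simp [h]

/-- Algebraic core: a map with orthonormal gradients which are consistent with a second-order
product rule has vanishing second derivatives. -/
theorem partialDeriv_partialDeriv_eq_zero {G : Set (Eucl d)} (hG : IsOpen G)
    {t : Fin d → Eucl d → ℂ} (ht : ∀ i, ContDiffOn ℝ ∞ (t i) G)
    (horth : ∀ x ∈ G, ∀ k l, ∑ i, partialDeriv k (t i) x * partialDeriv l (t i) x =
      if k = l then 1 else 0)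
    (horth' : ∀ x ∈ G, ∀ i j, gradDot (t i) (t j) x = if i = j then 1 else 0) {x : Eucl d}
    (hx : x ∈ G) (m k j : Fin d) : partialDeriv m (partialDeriv k (t j)) x = 0 := by
  have hta : ∀ i, ContDiffAt ℝ ∞ (t i) x := fun i => (ht i).contDiffAt (hG.mem_nhds hx)
  have hd : ∀ i k, DifferentiableAt ℝ (partialDeriv k (t i)) x := fun i k =>
    (contDiffAt_partialDeriv (hta i) k).differentiableAt (by simp)
  set S : Fin d → Fin d → Fin d → ℂ := fun m k l =>
    ∑ i, partialDeriv m (partialDeriv k (t i)) x * partialDeriv l (t i) x with hS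
  -- Differentiating `horth` makes `S` antisymmetric in its last two indices, while equality of
  -- mixed derivatives makes it symmetric in the first two. Such a tensor vanishes, as in the
  -- uniqueness of the Levi-Civita connection.
  have hanti : ∀ m k l, S m k l + S m l k = 0 := by
    intro m k l
    have h1 : (fun y => ∑ i, partialDeriv k (t i) y * partialDeriv l (t i) y) =ᶠ[𝓝 x]
        fun _ => if k = l then 1 else 0 := by
      filter_upwards [hG.mem_nhds hx] with y hy using horth y hy k l
    have h2 := partialDeriv_congr h1 m
    rw [partialDeriv_const] at h2
    rw [partialDeriv_sum _ fun i _ => (hd i k).fun_mul (hd i l)] at h2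
    rw [← h2, hS]
    simp only
    rw [← Finset.sum_add_distrib]
    refine Finset.sum_congr rfl fun i _ => ?_
    rw [partialDeriv_mul (hd i k) (hd i l) m]; ring
  have hsymm : ∀ m k l, S m k l = S k m l := fun m k l =>
    Finset.sum_congr rfl fun i _ => by rw [partialDeriv_comm (hta i)]
  have hzero : ∀ m k l, S m k l = 0 := by
    intro m k l
    have e1 := hanti m k l
    have e2 := hanti l m k
    have e3 := hanti k l m
    have s1 := hsymm m k l
    have s2 := hsymm l m k
    have s3 := hsymm k l m
    have : 2 * S m k l = 0 := by linear_combination e1 - e2 + e3 - s3 + s1 + s2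
    simpa using this
  -- Orthonormality of the gradients inverts the contraction defining `S`.
  have h3 : ∑ l, S m k l * partialDeriv l (t j) x = partialDeriv m (partialDeriv k (t j)) x := by
    simp only [hS, Finset.sum_mul]
    rw [Finset.sum_comm]
    have h4 : ∀ i, ∑ l, partialDeriv m (partialDeriv k (t i)) x * partialDeriv l (t i) x *
        partialDeriv l (t j) x = partialDeriv m (partialDeriv k (t i)) x * if i = j then 1 else 0 := by
      intro i
      rw [← horth' x hx i j, gradDot, Finset.mul_sum]
      exact Finset.sum_congr rfl fun l _ => by ring
    simp [h4]
  rw [← h3]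
  exact Finset.sum_eq_zero fun l _ => by rw [hzero, zero_mul]

/-- A weighted composition operator `p ↦ h · p ∘ T` which intertwines the Laplacian locally is a
constant multiple of composition with an affine isometry. -/
theorem exists_affineIsometry_of_intertwines (hd : 1 ≤ d) {G : Set (Eucl d)} (hG : IsOpen G)
    (hGc : IsPreconnected G) (hGn : G.Nonempty) {h : Eucl d → ℂ} {T : Eucl d → Eucl d}
    (hh : ContinuousOn h G) (hh0 : ∀ y ∈ G, h y ≠ 0) (hT : ContinuousOn T G)
    (H : ∀ p : Eucl d → ℂ, ContDiff ℝ ∞ p → ∀ y₀ ∈ G, ∃ V, IsOpen V ∧ y₀ ∈ V ∧ V ⊆ G ∧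
      ∀ φ, IsTestFunction V φ → ∫ y, (h y * p (T y)) * Laplacian.laplacian φ y =
        ∫ y, (h y * Laplacian.laplacian p (T y)) * φ y) :
    ∃ (A : Eucl d ≃ᵃⁱ[ℝ] Eucl d) (c : ℂ), c ≠ 0 ∧ ∀ y ∈ G, T y = A y ∧ h y = c := by
  have hlap : ∀ p : Eucl d → ℂ, ContDiff ℝ ∞ p → ∀ x, Laplacian.laplacian p x = coordLaplacian p x :=
    fun p hp x => laplacian_eq_sum ((contDiff_infty.1 hp 2).contDiffAt)
  -- For harmonic `p` the function `h * p ∘ T` is distributionally harmonic, hence smooth. Taking `p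
  -- = 1` and the coordinates gives smoothness of `h` and, after division by `h`, of `T`.
  have harm : ∀ p : Eucl d → ℂ, ContDiff ℝ ∞ p → (∀ x, coordLaplacian p x = 0) →
      ContDiffOn ℝ ∞ (fun y => h y * p (T y)) G := by
    intro p hp hp0 y hy
    obtain ⟨V, hV, hyV, hVG, hVφ⟩ := H p hp y hy
    have hc : ContinuousOn (fun y => h y * p (T y)) V :=
      (hh.mul (hp.continuous.comp_continuousOn hT)).mono hVG
    refine ((contDiffOn_of_distrib_harmonic hd hV hc fun φ hφ => ?_).contDiffAt
      (hV.mem_nhds hyV)).contDiffWithinAt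
    rw [hVφ φ hφ]
    simp [hlap p hp, hp0]
  have hdist : ∀ p : Eucl d → ℂ, ContDiff ℝ ∞ p → ContDiffOn ℝ ∞ (fun y => h y * p (T y)) G →
      ∀ x ∈ G, coordLaplacian (fun y => h y * p (T y)) x = h x * coordLaplacian p (T x) := by
    intro p hp hs x hx
    obtain ⟨V, hV, hyV, hVG, hVφ⟩ := H p hp x hx
    have hcl : ContinuousOn (fun y => h y * Laplacian.laplacian p (T y)) V :=
      (hh.mul ((continuous_laplacian hp).comp_continuousOn hT)).mono hVG
    have := laplacian_eq_of_distrib hV (hs.mono hVG) hcl hVφ x hyV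
    rw [hlap p hp] at this
    exact this
  set t : Fin d → Eucl d → ℂ := fun i y => ((T y i : ℝ) : ℂ) with ht
  have h1s : ContDiffOn ℝ ∞ h G := by
    have := harm (fun _ => 1) contDiff_const (fun x => Finset.sum_eq_zero fun k _ => by
      rw [show partialDeriv k (fun _ : Eucl d => (1 : ℂ)) = fun _ => 0 from
        funext fun y => partialDeriv_const _ _ _, partialDeriv_const])
    simpa using this
  have hti : ∀ i, ContDiffOn ℝ ∞ (fun y => h y * t i y) G := fun i =>
    harm _ (contDiff_coord i) (coordLaplacian_coord i)
  have hts : ∀ i, ContDiffOn ℝ ∞ (t i) G := fun i =>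
    (((h1s.inv hh0).mul (hti i))).congr fun y hy => by
      simp [inv_mul_cancel_left₀ (hh0 y hy)]
  have hdiff : ∀ {f : Eucl d → ℂ}, ContDiffOn ℝ ∞ f G → ∀ y ∈ G, DifferentiableAt ℝ f y :=
    fun hf y hy => (hf.contDiffAt (hG.mem_nhds hy)).differentiableAt (by simp)
  have L0 : ∀ x ∈ G, coordLaplacian h x = 0 := by
    intro x hx
    have := hdist (fun _ => 1) contDiff_const (by simpa using h1s) x hx
    have h0 : coordLaplacian (fun _ : Eucl d => (1 : ℂ)) (T x) = 0 :=
      Finset.sum_eq_zero fun k _ => by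
        rw [show partialDeriv k (fun _ : Eucl d => (1 : ℂ)) = fun _ => 0 from
          funext fun y => partialDeriv_const _ _ _, partialDeriv_const]
    rw [h0, mul_zero] at this
    simpa using this
  have L1 : ∀ i, ∀ x ∈ G, h x * coordLaplacian (t i) x + 2 * gradDot h (t i) x = 0 := by
    intro i x hx
    have := hdist _ (contDiff_coord i) (hti i) x hx
    rw [coordLaplacian_coord, mul_zero] at this
    have e := coordLaplacian_mul hG h1s (hts i) hx
    rw [L0 x hx, zero_mul, add_zero] at e
    rw [← e]; exact this
  have L1' : ∀ i, ∀ x ∈ G, coordLaplacian (fun y => h y * t i y) x = 0 := by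
    intro i x hx
    have := hdist _ (contDiff_coord i) (hti i) x hx
    rwa [coordLaplacian_coord, mul_zero] at this
  have horth' : ∀ x ∈ G, ∀ i j, gradDot (t i) (t j) x = if i = j then 1 else 0 := by
    intro x hx i j
    have hs : ContDiffOn ℝ ∞ (fun y => h y * (t i y * t j y)) G := h1s.mul ((hts i).mul (hts j))
    have e1 := hdist _ ((contDiff_coord i).mul (contDiff_coord j)) hs x hx
    rw [coordLaplacian_coord_mul] at e1
    have e2 := coordLaplacian_mul hG (hti i) (hts j) hx
    rw [L1' i x hx, gradDot_mul_left (hdiff h1s x hx) (hdiff (hts i) x hx)] at e2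
    have e3 : coordLaplacian (fun y => h y * (t i y * t j y)) x =
        coordLaplacian (fun y => h y * t i y * t j y) x := by simp_rw [mul_assoc]
    have e4 := L1 j x hx
    -- Expand `Δ((h t_i) t_j)` with `Δ(h t_i) = 0`; the relation `L1` for `j` cancels every term
    -- except `2 h ∇t_i · ∇t_j`.
    have e5 : h x * (2 * gradDot (t i) (t j) x) = h x * if i = j then 2 else 0 := by
      rw [← e1]
      refine Eq.trans ?_ e3.symm
      rw [e2]
      linear_combination -(t i x) * e4
    have e6 := mul_left_cancel₀ (hh0 x hx) e5
    split_ifs at e6 ⊢ with hij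
    · linear_combination e6 / 2
    · linear_combination e6 / 2
  have horth : ∀ x ∈ G, ∀ k l, ∑ i, partialDeriv k (t i) x * partialDeriv l (t i) x =
      if k = l then 1 else 0 := by
    intro x hx k l
    -- For a square Jacobian, orthonormal rows imply orthonormal columns.
    let J : Matrix (Fin d) (Fin d) ℂ := Matrix.of fun i k => partialDeriv k (t i) x
    have hJ : J * J.transpose = 1 := by
      ext i j
      rw [Matrix.mul_apply, Matrix.one_apply, ← horth' x hx i j]
      rfl
    have hJ' := mul_eq_one_comm.1 hJ
    have := congrFun (congrFun hJ' k) l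
    rw [Matrix.mul_apply, Matrix.one_apply] at this
    exact this
  have D2 : ∀ x ∈ G, ∀ m k j, partialDeriv m (partialDeriv k (t j)) x = 0 := fun x hx m k j =>
    partialDeriv_partialDeriv_eq_zero hG hts horth horth' hx m k j
  -- Now `Δ t_i = 0`, so `L1` says that `∇h` is orthogonal to every `∇t_i`, and these span.
  have Dh : ∀ x ∈ G, ∀ l, partialDeriv l h x = 0 := by
    intro x hx l
    have e1 : ∀ i, gradDot h (t i) x = 0 := by
      intro i
      have := L1 i x hx
      have h0 : coordLaplacian (t i) x = 0 := Finset.sum_eq_zero fun k _ => D2 x hx k k i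
      rw [h0, mul_zero, zero_add] at this
      simpa using this
    have e2 : ∑ i, partialDeriv l (t i) x * gradDot h (t i) x = partialDeriv l h x := by
      simp only [gradDot, Finset.mul_sum]
      rw [Finset.sum_comm]
      have e3 : ∀ k, ∑ i, partialDeriv l (t i) x * (partialDeriv k h x * partialDeriv k (t i) x) =
          partialDeriv k h x * if l = k then 1 else 0 := by
        intro k
        rw [← horth x hx l k, Finset.mul_sum]
        exact Finset.sum_congr rfl fun i _ => by ring
      simp [e3]
    rw [← e2]
    exact Finset.sum_eq_zero fun i _ => by rw [e1, mul_zero]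
  have const : ∀ f : Eucl d → ℂ, ContDiffOn ℝ ∞ f G → (∀ x ∈ G, ∀ l, partialDeriv l f x = 0) →
      ∀ x ∈ G, ∀ y ∈ G, f x = f y := fun f hf hf0 x hx y hy =>
    hG.is_const_of_fderiv_eq_zero hGc (hf.differentiableOn (by simp))
      (fun z hz => fderiv_eq_zero_of_partialDeriv (hf0 z hz)) hx hy
  obtain ⟨y₀, hy₀⟩ := hGn
  let a : Fin d → Fin d → ℝ := fun i k => (partialDeriv k (t i) y₀).re
  have ha : ∀ i k, ∀ x ∈ G, partialDeriv k (t i) x = a i k := by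
    intro i k x hx
    rw [const _ (ContDiffOn.partialDeriv hG (hts i) k) (fun z hz l => D2 z hz l k i) x hx y₀ hy₀]
    have h1 := (hdiff (hts i) y₀ hy₀).hasFDerivAt
    have h2 := ((Complex.ofRealCLM.comp Complex.reCLM).hasFDerivAt (x := t i y₀)).comp y₀ h1
    -- As `t i` is real-valued, projection to the real part fixes it and hence its derivative; the
    -- entries `a i k` lose nothing.
    have h3 : (Complex.ofRealCLM.comp Complex.reCLM) ∘ t i = t i := by
      funext y; simp [ht]
    rw [h3] at h2
    have h4 := congrArg (fun L => L (EuclideanSpace.single k 1)) (h1.unique h2)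
    simpa [a, partialDeriv] using h4
  have hformula : ∀ y ∈ G, ∀ i, T y i = T y₀ i + ∑ k, a i k * (y k - y₀ k) := by
    intro y hy i
    have hlin : ContDiff ℝ ∞ (fun y : Eucl d => ∑ k, (-(a i k : ℂ)) * ((y k : ℝ) : ℂ)) :=
      ContDiff.sum fun k _ => contDiff_const.mul (contDiff_coord k)
    have hc := const (fun y => t i y + ∑ k, (-(a i k : ℂ)) * ((y k : ℝ) : ℂ))
      ((hts i).add hlin.contDiffOn) (fun x hx l => by
        rw [partialDeriv_add (hdiff (hts i) x hx) (hlin.differentiable (by simp) x), ha i l x hx]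
        rw [partialDeriv_sum _ fun k _ =>
          (contDiff_const.mul (contDiff_coord k)).differentiable (by simp) x]
        have e : ∀ k, partialDeriv l (fun y : Eucl d => (-(a i k : ℂ)) * ((y k : ℝ) : ℂ)) x =
            -(a i k : ℂ) * if k = l then 1 else 0 := by
          intro k
          rw [partialDeriv_mul (by fun_prop) ((contDiff_coord k).differentiable (by simp) x),
            partialDeriv_const, partialDeriv_coord]
          simp
        simp only [e]
        simp) y hy y₀ hy₀
    have hc' := congrArg Complex.re hc
    simp [ht] at hc'
    simp only [mul_sub, Finset.sum_sub_distrib]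
    linarith
  have haorth : ∀ k l, ∑ i, a i k * a i l = if k = l then 1 else 0 := by
    intro k l
    have := horth y₀ hy₀ k l
    simp only [fun i k => ha i k y₀ hy₀] at this
    have h2 : ((∑ i, a i k * a i l : ℝ) : ℂ) = ((if k = l then 1 else 0 : ℝ) : ℂ) := by
      push_cast
      rw [this]
      split_ifs <;> simp
    exact_mod_cast h2
  let M : Matrix (Fin d) (Fin d) ℝ := Matrix.of a
  let Lin : Eucl d →ₗ[ℝ] Eucl d := Matrix.toEuclideanLin M
  have hLin : ∀ w i, Lin w i = ∑ k, a i k * w k := fun w i => by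
    simp [Lin, M, Matrix.mulVec, dotProduct]
  have hnorm : ∀ w, ‖Lin w‖ = ‖w‖ := by
    intro w
    have : ‖Lin w‖ ^ 2 = ‖w‖ ^ 2 := by
      rw [EuclideanSpace.norm_sq_eq, EuclideanSpace.norm_sq_eq]
      simp only [Real.norm_eq_abs, sq_abs, hLin]
      have e1 : ∀ i, (∑ k, a i k * w k) ^ 2 = ∑ k, ∑ l, (a i k * a i l) * (w k * w l) := by
        intro i
        rw [sq, Finset.sum_mul_sum]
        exact Finset.sum_congr rfl fun k _ => Finset.sum_congr rfl fun l _ => by ring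
      simp_rw [e1]
      rw [Finset.sum_comm]
      refine Finset.sum_congr rfl fun k _ => ?_
      rw [Finset.sum_comm]
      simp_rw [← Finset.sum_mul, haorth]
      simp [sq]
    exact (sq_eq_sq₀ (norm_nonneg _) (norm_nonneg _)).1 this
  let Li : Eucl d ≃ₗᵢ[ℝ] Eucl d := (⟨Lin, hnorm⟩ : Eucl d →ₗᵢ[ℝ] Eucl d).toLinearIsometryEquiv rfl
  refine ⟨AffineIsometryEquiv.mk' (fun y => Li (y - y₀) + T y₀) Li y₀ (fun y => by simp), h y₀,
    hh0 y₀ hy₀, fun y hy => ⟨?_, const h h1s Dh y hy y₀ hy₀⟩⟩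
  ext i
  rw [hformula y hy i, AffineIsometryEquiv.coe_mk']
  have : (Li (y - y₀)) i = ∑ k, a i k * (y k - y₀ k) := hLin (y - y₀) i
  rw [PiLp.add_apply, this, add_comm]

/-! ### Test functions, traces and the Robin condition -/

theorem exists_cutoff (z : Eucl d) {R r : ℝ} (hR : 0 < R) (hr : R < r) :
    ∃ χ : Eucl d → ℝ, ContDiff ℝ ∞ χ ∧ HasCompactSupport χ ∧ tsupport χ ⊆ Metric.ball z r ∧
      (∀ x, 0 ≤ χ x) ∧ ∀ x ∈ Metric.closedBall z R, χ x = 1 := by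
  let b : ContDiffBump z := ⟨R, (R + r) / 2, hR, by linarith⟩
  refine ⟨b, b.contDiff, b.hasCompactSupport, ?_, fun x => b.nonneg,
    fun x hx => b.one_of_mem_closedBall hx⟩
  rw [b.tsupport_eq]
  exact Metric.closedBall_subset_ball (by simp only [b]; linarith)

theorem IsTestFunction.mono {Ω Ω' : Set (Eucl d)} (h : Ω ⊆ Ω') {φ : Eucl d → ℂ}
    (hφ : IsTestFunction Ω φ) : IsTestFunction Ω' φ :=
  ⟨hφ.smooth, hφ.compact, hφ.support.trans h⟩

theorem IsTestFunction.mul_left {Ω : Set (Eucl d)} {φ p : Eucl d → ℂ} (hφ : IsTestFunction Ω φ)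
    (hp : ContDiff ℝ ∞ p) : IsTestFunction Ω fun x => p x * φ x :=
  ⟨hp.mul hφ.smooth, hφ.compact.mul_left, (tsupport_mul_subset_right).trans hφ.support⟩

theorem isTestFunction_ofReal {Ω : Set (Eucl d)} {φ : Eucl d → ℝ} (h : ContDiff ℝ ∞ φ)
    (hc : HasCompactSupport φ) (hs : tsupport φ ⊆ Ω) : IsTestFunction Ω fun x => (φ x : ℂ) := by
  have hcs : tsupport (fun x => (φ x : ℂ)) = tsupport φ := by
    unfold tsupport; congr 1; ext x; simp
  exact ⟨Complex.ofRealCLM.contDiff.comp h, by rw [HasCompactSupport, hcs]; exact hc, by rwa [hcs]⟩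

theorem IsTestFunction.eq_zero {Ω : Set (Eucl d)} {φ : Eucl d → ℂ} (hφ : IsTestFunction Ω φ)
    {x : Eucl d} (hx : x ∉ Ω) : φ x = 0 :=
  image_eq_zero_of_notMem_tsupport fun h => hx (hφ.support h)

theorem IsTestFunction.laplacian_eq_zero {Ω : Set (Eucl d)} {φ : Eucl d → ℂ}
    (hφ : IsTestFunction Ω φ) {x : Eucl d} (hx : x ∉ Ω) : Laplacian.laplacian φ x = 0 :=
  laplacian_eq_zero_of_notMem fun h => hx (hφ.support h)

/-- The indicator function of a Lipschitz domain has nonzero weak gradient near each boundary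
point. -/
theorem exists_integral_partialDeriv_ne_zero {Ω : Set (Eucl d)} (hΩ : IsLipschitzDomain Ω)
    {q : Eucl d} (hq : q ∈ frontier Ω) {r : ℝ} (hr : 0 < r) :
    ∃ v, IsTestFunction (Metric.ball q r) v ∧ ∃ j, ∫ x in Ω, partialDeriv j v x ≠ 0 := by
  by_contra! hcon
  obtain ⟨x₀, hx₀q, hx₀⟩ := mem_closure_iff_nhds.1 (frontier_subset_closure hq) _
    (Metric.ball_mem_nhds q hr)
  obtain ⟨x₁, hx₁q, hx₁⟩ := mem_closure_iff_nhds.1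
    (hΩ.lipschitz.frontier_subset_closure_compl hΩ.isOpen hq) _ (Metric.ball_mem_nhds q hr)
  obtain ⟨δ₀, hδ₀, hδ₀'⟩ := Metric.isOpen_iff.1 (hΩ.isOpen.inter Metric.isOpen_ball) x₀ ⟨hx₀, hx₀q⟩
  obtain ⟨δ₁, hδ₁, hδ₁'⟩ := Metric.isOpen_iff.1
    (isClosed_closure.isOpen_compl.inter Metric.isOpen_ball) x₁ ⟨hx₁, hx₁q⟩
  rw [Metric.mem_ball] at hx₀q hx₁q
  obtain ⟨δ, hδ, hδm⟩ : ∃ δ : ℝ, 0 < δ ∧ δ < min (min δ₀ δ₁) (min (r - dist x₀ q) (r - dist x₁ q)) :=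
    exists_between (lt_min (lt_min hδ₀ hδ₁) (lt_min (by linarith) (by linarith)))
  simp only [lt_min_iff] at hδm
  obtain ⟨ψ, hψ, hψc, hψs, hψ0, hψ1⟩ := exists_cutoff (0 : Eucl d) (half_pos hδ) (half_lt_self hδ)
  have hψz : ∀ z : Eucl d, δ ≤ ‖z‖ → ψ z = 0 := fun z hz =>
    image_eq_zero_of_notMem_tsupport fun h => by
      have := hψs h
      rw [mem_ball_zero_iff] at this
      linarith
  set w := x₁ - x₀ with hw
  have hfin : IsFiniteMeasure (volume.restrict Ω) :=
    ⟨by rw [Measure.restrict_apply_univ]; exact hΩ.isBounded.measure_lt_top⟩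
  -- A bump is slid from an interior point `x₀` to an exterior point `x₁` inside the ball around
  -- `q`. If all weak derivatives of the indicator vanished there, its mass in `Ω` would not change,
  -- yet it drops from positive to zero.
  set F : ℝ → ℝ := fun t => ∫ x in Ω, ψ (x - (x₀ + t • w)) with hF
  have hψd : Differentiable ℝ ψ := hψ.differentiable (by simp)
  have hDcont : Continuous (fderiv ℝ ψ) := hψ.continuous_fderiv (by simp)
  obtain ⟨B, hB⟩ := (hψc.fderiv ℝ).exists_bound_of_continuous hDcont
  obtain ⟨Bψ, hBψ⟩ := hψc.exists_bound_of_continuous hψ.continuous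
  have hzero : ∀ t ∈ Icc (0 : ℝ) 1, ∫ x in Ω, fderiv ℝ ψ (x - (x₀ + t • w)) (-w) = 0 := by
    intro t ht
    set y := x₀ + t • w with hy
    have hyq : dist y q + δ < r := by
      have h1 : y = (1 - t) • x₀ + t • x₁ := by rw [hy, hw]; module
      have h2 : y - q = (1 - t) • (x₀ - q) + t • (x₁ - q) := by rw [h1]; module
      have h3 := norm_add_le ((1 - t) • (x₀ - q)) (t • (x₁ - q))
      rw [norm_smul, norm_smul, Real.norm_of_nonneg ht.1,
        Real.norm_of_nonneg (by linarith [ht.2]), ← h2, ← dist_eq_norm, ← dist_eq_norm,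
        ← dist_eq_norm] at h3
      have := ht.1; have := ht.2
      have h4 : (1 - t) * dist x₀ q ≤ (1 - t) * max (dist x₀ q) (dist x₁ q) :=
        mul_le_mul_of_nonneg_left (le_max_left _ _) (by linarith)
      have h5 : t * dist x₁ q ≤ t * max (dist x₀ q) (dist x₁ q) :=
        mul_le_mul_of_nonneg_left (le_max_right _ _) (by linarith)
      have h6 : max (dist x₀ q) (dist x₁ q) + δ < r := by
        rcases max_choice (dist x₀ q) (dist x₁ q) with h | h <;> rw [h] <;> linarith [hδm.2.1, hδm.2.2]
      linarith
    have hsm : ContDiff ℝ ∞ fun x => ψ (x - y) := hψ.comp (contDiff_id.sub contDiff_const)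
    have hsup : tsupport (fun x => ψ (x - y)) ⊆ Metric.closedBall y δ := by
      refine closure_minimal (fun x hx => ?_) Metric.isClosed_closedBall
      by_contra hc
      rw [Metric.mem_closedBall, dist_eq_norm, not_le] at hc
      exact hx (hψz _ hc.le)
    have htest : IsTestFunction (Metric.ball q r) fun x => ((ψ (x - y) : ℝ) : ℂ) := by
      refine isTestFunction_ofReal hsm
        (HasCompactSupport.of_support_subset_isCompact (isCompact_closedBall y δ)
          (subset_closure.trans hsup)) (hsup.trans ?_)
      exact Metric.closedBall_subset_ball' (by linarith)
    have hpd : ∀ j x, partialDeriv j (fun x => ((ψ (x - y) : ℝ) : ℂ)) x =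
        ((fderiv ℝ ψ (x - y) (EuclideanSpace.single j 1) : ℝ) : ℂ) := by
      intro j x
      have h1 : HasFDerivAt (fun x => ((ψ (x - y) : ℝ) : ℂ))
          (Complex.ofRealCLM.comp (fderiv ℝ ψ (x - y))) x := by
        have h2 := (hψd (x - y)).hasFDerivAt.comp x ((hasFDerivAt_id x).sub_const y)
        rw [ContinuousLinearMap.comp_id] at h2
        exact Complex.ofRealCLM.hasFDerivAt.comp x h2
      unfold partialDeriv
      rw [h1.fderiv]; rfl
    have hj : ∀ j, ∫ x in Ω, fderiv ℝ ψ (x - y) (EuclideanSpace.single j 1) = 0 := by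
      intro j
      have := hcon _ htest j
      simp_rw [hpd] at this
      rw [integral_complex_ofReal] at this
      exact_mod_cast this
    have hexp : ∀ x, fderiv ℝ ψ (x - y) (-w) =
        ∑ j, (-w) j * fderiv ℝ ψ (x - y) (EuclideanSpace.single j 1) := by
      intro x
      have h1 := (EuclideanSpace.basisFun (Fin d) ℝ).sum_repr (-w)
      conv_lhs => rw [← h1]
      rw [map_sum]
      refine Finset.sum_congr rfl fun j _ => ?_
      simp
    simp_rw [hexp]
    rw [integral_finsetSum]
    · refine Finset.sum_eq_zero fun j _ => ?_
      rw [integral_const_mul, hj, mul_zero]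
    · intro j _
      refine Integrable.const_mul ?_ _
      refine Integrable.of_bound (Continuous.aestronglyMeasurable (by fun_prop))
        (B * ‖(EuclideanSpace.single j 1 : Eucl d)‖) (ae_of_all _ fun x => ?_)
      exact (ContinuousLinearMap.le_opNorm _ _).trans
        (mul_le_mul_of_nonneg_right (hB _) (norm_nonneg _))
  have hderiv : ∀ t ∈ Icc (0 : ℝ) 1, HasDerivAt F 0 t := by
    intro t ht
    rw [← hzero t ht]
    refine (hasDerivAt_integral_of_dominated_loc_of_deriv_le (s := univ)
      (F' := fun t x => fderiv ℝ ψ (x - (x₀ + t • w)) (-w)) (bound := fun _ => B * ‖-w‖)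
      univ_mem (Eventually.of_forall fun s => ?_) ?_ ?_
      (ae_of_all _ fun x s _ => ?_) (integrable_const _) (ae_of_all _ fun x s _ => ?_)).2
    · have := hψ.continuous
      exact Continuous.aestronglyMeasurable (by fun_prop)
    · have := hψ.continuous
      exact Integrable.of_bound (Continuous.aestronglyMeasurable (by fun_prop)) Bψ
        (ae_of_all _ fun x => hBψ _)
    · exact Continuous.aestronglyMeasurable (by fun_prop)
    · exact (ContinuousLinearMap.le_opNorm _ _).trans
        (mul_le_mul_of_nonneg_right (hB _) (norm_nonneg _))
    · have h1 : HasDerivAt (fun s : ℝ => x - (x₀ + s • w)) (-w) s := by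
        have := (((hasDerivAt_id s).smul_const w).const_add x₀).const_sub x
        simpa using this
      exact (hψd _).hasFDerivAt.comp_hasDerivAt s h1
  have hconst : F 1 = F 0 := constant_of_has_deriv_right_zero (a := 0) (b := 1)
    (fun t ht => (hderiv t ht).continuousAt.continuousWithinAt)
    (fun t ht => (hderiv t ⟨ht.1, ht.2.le⟩).hasDerivWithinAt) 1 ⟨zero_le_one, le_rfl⟩
  have hF1 : F 1 = 0 := by
    refine (setIntegral_congr_fun hΩ.isOpen.measurableSet (g := fun _ => (0 : ℝ)) fun x hx => ?_).trans
      (by simp)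
    refine hψz _ ?_
    by_contra! h
    have h1 : x₀ + (1 : ℝ) • w = x₁ := by rw [hw]; module
    rw [h1, ← dist_eq_norm] at h
    exact (hδ₁' (Metric.mem_ball.2 (h.trans hδm.1.2))).1 (subset_closure hx)
  have hF0 : 0 < F 0 := by
    have h1 : F 0 = ∫ x, ψ (x - x₀) := by
      simp only [hF, zero_smul, add_zero]
      refine setIntegral_eq_integral_of_forall_compl_eq_zero fun x hx => hψz _ ?_
      by_contra! h
      rw [← dist_eq_norm] at h
      exact hx (hδ₀' (Metric.mem_ball.2 (h.trans hδm.1.1))).1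
    rw [h1, integral_sub_right_eq_self]
    refine hψ.continuous.integral_pos_of_hasCompactSupport_nonneg_nonzero hψc hψ0 (x := 0) ?_
    rw [hψ1 0 (Metric.mem_closedBall_self (half_pos hδ).le)]
    exact one_ne_zero
  linarith

theorem setIntegral_eq_of_test {Ω O : Set (Eucl d)} (h : O ⊆ Ω) {φ f : Eucl d → ℂ}
    (hφ : ∀ x ∉ O, φ x = 0) : ∫ x in Ω, f x * φ x = ∫ x, f x * φ x :=
  setIntegral_eq_integral_of_forall_compl_eq_zero fun x hx => by
    rw [hφ x fun h' => hx (h h'), mul_zero]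

theorem IsTestFunction.hasH1Gradient {Ω O : Set (Eucl d)} {v : Eucl d → ℂ}
    (hv : IsTestFunction O v) : HasH1Gradient Ω v fun j => RobinIntertwining.partialDeriv j v where
  memLp := (hv.smooth.continuous.memLp_of_hasCompactSupport hv.compact).restrict _
  memLp_grad j := ((hv.pderiv j).smooth.continuous.memLp_of_hasCompactSupport
    (hv.pderiv j).compact).restrict _
  weak φ hφ j := by
    rw [setIntegral_eq_of_test subset_rfl fun x hx => (hφ.pderiv j).eq_zero hx,
      setIntegral_eq_of_test subset_rfl fun x hx => hφ.eq_zero hx]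
    exact integral_mul_partialDeriv isOpen_univ hv.smooth.contDiffOn (hφ.mono (subset_univ _)) j

/-- The constant sequence `v` serves as approximation; finiteness of the surface measure is needed
only to have `v ∈ L²(∂Ω)`. -/
theorem IsTestFunction.isTrace {Ω : Set (Eucl d)} {v : Eucl d → ℂ} {q : Eucl d} {R : ℝ}
    (hv : IsTestFunction (Metric.ball q R) v) (hs : surface Ω (Metric.closedBall q R) < ⊤) :
    IsTrace Ω v (fun j => partialDeriv j v) v where
  memLp := by
    have h1 : v = (Metric.closedBall q R).indicator v := by
      refine (indicator_eq_self.2 fun x hx => ?_).symm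
      exact Metric.ball_subset_closedBall (hv.support (subset_tsupport _ hx))
    obtain ⟨B, hB⟩ := hv.compact.exists_bound_of_continuous hv.smooth.continuous
    rw [h1, memLp_indicator_iff_restrict Metric.isClosed_closedBall.measurableSet]
    have : IsFiniteMeasure ((surface Ω).restrict (Metric.closedBall q R)) :=
      ⟨by rwa [Measure.restrict_apply_univ]⟩
    exact MemLp.of_bound hv.smooth.continuous.aestronglyMeasurable B (ae_of_all _ hB)
  approx := ⟨fun _ => v, fun _ => hv.mono (subset_univ _), by simp, fun j => by simp, by simp⟩

/-- Weak gradient and distributional Laplacian of a function which is smooth on an open subset are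
the classical ones there. -/
theorem ae_eq_of_hasH1Gradient {Ω O : Set (Eucl d)} (hΩ : IsLipschitzDomain Ω) (hO : IsOpen O)
    (hOΩ : O ⊆ Ω) {u w g : Eucl d → ℂ} {G : Fin d → Eucl d → ℂ} (hG : HasH1Gradient Ω u G)
    (hw : MemLp w 2 (volume.restrict Ω)) (hl : HasDistribLaplacian Ω u w) (hg : ContDiff ℝ ∞ g)
    (hug : ∀ x ∈ O, u x = g x) :
    (∀ j, ∀ᵐ x, x ∈ O → G j x = partialDeriv j g x) ∧
      ∀ᵐ x, x ∈ O → w x = Laplacian.laplacian g x := by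
  have hfin : IsFiniteMeasure (volume.restrict Ω) :=
    ⟨by rw [Measure.restrict_apply_univ]; exact hΩ.isBounded.measure_lt_top⟩
  have hloc : ∀ f : Eucl d → ℂ, MemLp f 2 (volume.restrict Ω) → LocallyIntegrableOn f O := by
    intro f hf
    have : IntegrableOn f Ω := hf.integrable (by norm_num)
    exact (this.mono_set hOΩ).locallyIntegrableOn
  have hcongr : ∀ ψ : Eucl d → ℂ, (∀ x ∉ O, ψ x = 0) → ∫ x, u x * ψ x = ∫ x, g x * ψ x := by
    intro ψ hψ
    refine integral_congr_ae (ae_of_all _ fun x => ?_)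
    by_cases hx : x ∈ O
    · simp only [hug x hx]
    · simp only [hψ x hx, mul_zero]
  refine ⟨fun j => ?_, ?_⟩
  · refine eqOn_of_integral_mul_eq hO (hloc _ (hG.memLp_grad j))
      ((contDiff_iff_contDiffAt.2 fun x => contDiffAt_partialDeriv hg.contDiffAt
        j).continuous.continuousOn.locallyIntegrableOn hO.measurableSet) fun φ hφ => ?_
    have h1 := hG.weak φ (hφ.mono hOΩ) j
    rw [setIntegral_eq_of_test hOΩ fun x hx => (hφ.pderiv j).eq_zero hx,
      setIntegral_eq_of_test hOΩ fun x hx => hφ.eq_zero hx,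
      hcongr _ fun x hx => (hφ.pderiv j).eq_zero hx,
      integral_mul_partialDeriv isOpen_univ hg.contDiffOn (hφ.mono (subset_univ _)) j] at h1
    exact (neg_injective h1).symm
  · have h2 : ∀ φ, IsTestFunction O φ → ∫ x, g x * Laplacian.laplacian φ x = ∫ x, w x * φ x := by
      intro φ hφ
      have h1 := hl φ (hφ.mono hOΩ)
      rwa [setIntegral_eq_of_test hOΩ fun x hx => hφ.laplacian_eq_zero hx,
        setIntegral_eq_of_test hOΩ fun x hx => hφ.eq_zero hx,
        hcongr _ fun x hx => hφ.laplacian_eq_zero hx] at h1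
    refine eqOn_of_integral_mul_eq hO (hloc _ hw)
      ((continuous_laplacian hg).continuousOn.locallyIntegrableOn hO.measurableSet) fun φ hφ => ?_
    rw [← h2 φ hφ]
    rw [integral_mul_laplacian isOpen_univ hg.contDiffOn (hφ.mono (subset_univ _))]
    refine integral_congr_ae (ae_of_all _ fun x => ?_)
    simp only [laplacian_eq_sum ((contDiff_infty.1 hg 2).contDiffAt)]

/-- Not every smooth function can satisfy, locally, the same Robin boundary condition. -/
theorem not_forall_robin (hd : 1 ≤ d) {Ω : Set (Eucl d)} (hΩ : IsLipschitzDomain Ω) {q : Eucl d}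
    (hq : q ∈ frontier Ω) {r : ℝ} (hr : 0 < r) {β : Eucl d → ℂ} {c : ℂ} (hc : c ≠ 0)
    (H : ∀ g, IsTestFunction (Metric.ball q r) g → ∃ u : Eucl d → ℂ,
      HasNormalDerivative Ω u (fun x => -β x * u x) ∧
        ∀ y ∈ Metric.ball q r ∩ closure Ω, u y = c * g y) : False := by
  obtain ⟨r₁, hr₁, hsurf⟩ := hΩ.lipschitz.exists_surface_lt_top hd hΩ.isOpen hq
  set R := min (r / 2) r₁ with hRdef
  have hR : 0 < R := lt_min (half_pos hr) hr₁
  have hRr : R < r := (min_le_left _ _).trans_lt (half_lt_self hr)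
  have hsurfR : surface Ω (Metric.closedBall q R) < ⊤ :=
    (measure_mono (Metric.closedBall_subset_closedBall (min_le_right _ _))).trans_lt hsurf
  obtain ⟨χ, hχ, hχc, hχs, -, hχ1⟩ := exists_cutoff q hR hRr
  -- Green's formula with the Robin condition, localised: `p` cut off by `χ` is admissible in `H`,
  -- and `v` sees only the region where `χ = 1`.
  have key : ∀ p : Eucl d → ℂ, ContDiff ℝ ∞ p → ∀ v, IsTestFunction (Metric.ball q R) v →
      ∫ x in Ω, ((∑ j, c * partialDeriv j p x * conj (partialDeriv j v x)) +
        c * Laplacian.laplacian p x * conj (v x)) =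
      ∫ x, (-β x * (c * p x)) * conj (v x) ∂(surface Ω) := by
    intro p hp v hv
    have hg := (isTestFunction_ofReal hχ hχc hχs).mul_left hp
    set g : Eucl d → ℂ := fun x => p x * (χ x : ℂ) with hgdef
    obtain ⟨u, ⟨G, w, hG, hw, hl, -, hgreen⟩, hu⟩ := H g hg
    have hcg : ContDiff ℝ ∞ fun x => c * p x := contDiff_const.mul hp
    have hgp : ∀ x ∈ Metric.ball q R, g x = p x := fun x hx => by
      simp [hgdef, hχ1 x (Metric.ball_subset_closedBall hx)]
    have hup : ∀ x ∈ Metric.ball q R ∩ closure Ω, u x = c * p x := fun x hx => by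
      rw [hu x ⟨Metric.ball_subset_ball hRr.le hx.1, hx.2⟩, hgp x hx.1]
    obtain ⟨hae, hae'⟩ := ae_eq_of_hasH1Gradient hΩ (Metric.isOpen_ball.inter hΩ.isOpen)
      (inter_subset_right (s := Metric.ball q R)) hG hw hl hcg
      fun x hx => hup x ⟨hx.1, subset_closure hx.2⟩
    have h1 := hgreen v _ v hv.hasH1Gradient (hv.isTrace hsurfR)
    refine Eq.trans ?_ (h1.trans ?_)
    · refine integral_congr_ae ((ae_restrict_iff' hΩ.isOpen.measurableSet).2 ?_)
      filter_upwards [ae_all_iff.2 hae, hae'] with x hx hx' hxΩ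
      by_cases hxR : x ∈ Metric.ball q R
      · have hL : Laplacian.laplacian (fun x => c * p x) x = c * Laplacian.laplacian p x := by
          have := laplacian_smul (𝕜 := ℂ) (f := p) (x := x) c ((contDiff_infty.1 hp 2).contDiffAt)
          exact this
        have hP : ∀ j, partialDeriv j (fun x => c * p x) x = c * partialDeriv j p x := fun j => by
          rw [partialDeriv_mul (by fun_prop) (hp.differentiable (by simp) x), partialDeriv_const,
            zero_mul, add_zero]
        simp only [hx _ ⟨hxR, hxΩ⟩, hx' ⟨hxR, hxΩ⟩, hL, hP]
      · simp only [hv.eq_zero hxR, (hv.pderiv _).eq_zero hxR, map_zero, mul_zero]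
    · unfold surface
      refine setIntegral_congr_fun isClosed_frontier.measurableSet fun x hx => ?_
      by_cases hxR : x ∈ Metric.ball q R
      · simp only [hup x ⟨hxR, frontier_subset_closure hx⟩]
      · simp only [hv.eq_zero hxR, map_zero, mul_zero]
  have hlap1 : ∀ x, Laplacian.laplacian (fun _ : Eucl d => (1 : ℂ)) x = 0 := fun x => by
    simp
  -- For `p = 1` the volume side is zero, so `β` annihilates the test functions near `q`.
  have hβ : ∀ v, IsTestFunction (Metric.ball q R) v →
      ∫ x, -β x * c * conj (v x) ∂(surface Ω) = 0 := by
    intro v hv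
    have := key (fun _ => 1) contDiff_const v hv
    simp only [partialDeriv_const, hlap1, mul_zero, zero_mul, Finset.sum_const_zero, add_zero,
      integral_zero, mul_one] at this
    exact this.symm
  obtain ⟨v, hv, j, hj⟩ := exists_integral_partialDeriv_ne_zero hΩ hq hR
  refine hj ?_
  have h1 := key _ (contDiff_coord j) v hv
  -- For `p = x_j` the surface side is `hβ` applied to `x_j v`, hence zero, while the volume side is
  -- the integral of `c` times the conjugate of `∂_j v`.
  have h2 := hβ _ (hv.mul_left (contDiff_coord j))
  have h3 : ∀ x, Laplacian.laplacian (fun y : Eucl d => ((y j : ℝ) : ℂ)) x = 0 := fun x => by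
    rw [laplacian_eq_sum ((contDiff_infty.1 (contDiff_coord j) 2).contDiffAt)]
    exact coordLaplacian_coord j x
  have h4 : ∫ x in Ω, c * conj (partialDeriv j v x) = 0 := by
    rw [← h2]
    refine Eq.trans ?_ (h1.trans ?_)
    · refine integral_congr_ae (ae_of_all _ fun x => ?_)
      simp [h3, partialDeriv_coord]
    · refine integral_congr_ae (ae_of_all _ fun x => ?_)
      simp only [map_mul, Complex.conj_ofReal]
      ring
  rw [integral_const_mul, integral_conj] at h4
  simpa [hc] using h4

/-! ### From a weighted composition to a congruence -/

/-- A weighted composition operator that intertwines the Laplacian, is non-degenerate and maps test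
functions to functions satisfying a Robin boundary condition is given by a congruence. -/
theorem exists_congruence (hd : 2 ≤ d) {Ω₁ Ω₂ : Set (Eucl d)}
    (hΩ₁ : IsLipschitzDomain Ω₁) (hΩ₂ : IsLipschitzDomain Ω₂) (hC1 : HasC1Boundary Ω₁)
    {h : Eucl d → ℂ} {T : Eucl d → Eucl d} (hh : ContinuousOn h (closure Ω₂))
    (hT : ContinuousOn T (closure Ω₂ ∩ {y | h y ≠ 0})) {β : Eucl d → ℂ}
    (Hlap : ∀ f, IsTestFunction Ω₁ f → ∀ φ, IsTestFunction Ω₂ φ →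
      ∫ y in Ω₂, (h y * f (T y)) * Laplacian.laplacian φ y =
        ∫ y in Ω₂, (h y * Laplacian.laplacian f (T y)) * φ y)
    (Hrob : ∀ f, IsTestFunction Ω₁ f → ∃ u : Eucl d → ℂ,
      HasNormalDerivative Ω₂ u (fun x => -β x * u x) ∧ ∀ y ∈ closure Ω₂, u y = h y * f (T y))
    (Hnd : ∀ W, IsOpen W → W ⊆ Ω₂ →
      (∀ f, IsTestFunction Ω₁ f → ∀ y ∈ W, h y * f (T y) = 0) → W = ∅) :
    ∃ (A : Eucl d ≃ᵃⁱ[ℝ] Eucl d) (c : ℂ), c ≠ 0 ∧ A ⁻¹' Ω₁ = Ω₂ ∧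
      ∀ y ∈ closure Ω₂, T y = A y ∧ h y = c := by
  have hd1 : 1 ≤ d := by omega
  have hcl₂ : ∀ y ∈ Ω₂, closure Ω₂ ∈ 𝓝 y := fun y hy =>
    mem_of_superset (hΩ₂.isOpen.mem_nhds hy) subset_closure
  have hhne : ∀ y ∈ closure Ω₂, h y ≠ 0 → ∀ᶠ z in 𝓝[closure Ω₂] y, h z ≠ 0 := fun y hy hy0 =>
    (hh y hy).eventually_ne hy0
  have hTc : ∀ y ∈ closure Ω₂, h y ≠ 0 → ContinuousWithinAt T (closure Ω₂) y := fun y hy hy0 =>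
    (hT y ⟨hy, hy0⟩).mono_of_mem_nhdsWithin (inter_mem self_mem_nhdsWithin (hhne y hy hy0))
  set W : Set (Eucl d) := {y | y ∈ Ω₂ ∧ h y ≠ 0 ∧ T y ∈ Ω₁} with hW
  have hWnear : ∀ y ∈ closure Ω₂, h y ≠ 0 → T y ∈ Ω₁ →
      ∀ᶠ z in 𝓝[closure Ω₂] y, h z ≠ 0 ∧ T z ∈ Ω₁ := fun y hy hy0 hyT =>
    (hhne y hy hy0).and ((hTc y hy hy0).eventually (hΩ₁.isOpen.mem_nhds hyT))
  have hWo : IsOpen W := by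
    refine isOpen_iff_mem_nhds.2 fun y hy => ?_
    have h1 := hWnear y (subset_closure hy.1) hy.2.1 hy.2.2
    rw [nhdsWithin_eq_nhds.2 (hcl₂ y hy.1)] at h1
    filter_upwards [hΩ₂.isOpen.mem_nhds hy.1, h1] with z hz1 hz2 using ⟨hz1, hz2⟩
  have hWΩ : W ⊆ Ω₂ := fun y hy => hy.1
  have hdense : Ω₂ ⊆ closure W := by
    have h1 := Hnd (Ω₂ ∩ (closure W)ᶜ) (hΩ₂.isOpen.inter isClosed_closure.isOpen_compl)
      inter_subset_left ?_
    · intro y hy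
      by_contra hyn
      have : y ∈ Ω₂ ∩ (closure W)ᶜ := ⟨hy, hyn⟩
      rw [h1] at this; exact this
    · intro f hf y hy
      by_contra hne
      refine hy.2 (subset_closure ⟨hy.1, left_ne_zero_of_mul hne, ?_⟩)
      by_contra hTy
      exact right_ne_zero_of_mul hne (hf.eq_zero hTy)
  -- On the closure `h` still equals `c ≠ 0` by continuity, so `T` is continuous there and the
  -- formula for `T` passes to the limit.
  have hext : ∀ (S : Set (Eucl d)) (A : Eucl d ≃ᵃⁱ[ℝ] Eucl d) (c : ℂ), S ⊆ Ω₂ → c ≠ 0 →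
      (∀ y ∈ S, T y = A y ∧ h y = c) → ∀ y ∈ closure S, T y = A y ∧ h y = c := by
    intro S A c hS hc hSA y hy
    have hyc := closure_mono hS hy
    have hne : (𝓝[S] y).NeBot := mem_closure_iff_nhdsWithin_neBot.1 hy
    have hsub : S ⊆ closure Ω₂ := hS.trans subset_closure
    have e1 : h y = c := by
      refine tendsto_nhds_unique ((hh y hyc).mono hsub) (tendsto_const_nhds.congr' ?_)
      filter_upwards [self_mem_nhdsWithin] with z hz using (hSA z hz).2.symm
    refine ⟨?_, e1⟩
    refine tendsto_nhds_unique ((hTc y hyc (e1 ▸ hc)).mono hsub)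
      ((A.continuous.continuousWithinAt (s := S) (x := y)).congr' ?_)
    filter_upwards [self_mem_nhdsWithin] with z hz using (hSA z hz).1.symm
  have hcomp : ∀ y₀ ∈ W, ∃ (A : Eucl d ≃ᵃⁱ[ℝ] Eucl d) (c : ℂ), c ≠ 0 ∧
      ∀ y ∈ connectedComponentIn W y₀, T y = A y ∧ h y = c := by
    intro y₀ hy₀
    have hGW := connectedComponentIn_subset W y₀
    have hGo : IsOpen (connectedComponentIn W y₀) := hWo.connectedComponentIn
    have hTG : ContinuousOn T (connectedComponentIn W y₀) := hT.mono fun y hy =>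
      ⟨subset_closure (hGW hy).1, (hGW hy).2.1⟩
    refine exists_affineIsometry_of_intertwines hd1 hGo isPreconnected_connectedComponentIn
      ⟨y₀, mem_connectedComponentIn hy₀⟩ (hh.mono fun y hy => subset_closure (hGW hy).1)
      (fun y hy => (hGW hy).2.1) hTG fun p hp y₁ hy₁ => ?_
    obtain ⟨r, hr, hball⟩ := Metric.isOpen_iff.1 hΩ₁.isOpen _ (hGW hy₁).2.2
    obtain ⟨χ, hχ, hχc, hχs, -, hχ1⟩ := exists_cutoff (T y₁) (half_pos hr) (half_lt_self hr)
    have hf := ((isTestFunction_ofReal hχ hχc hχs).mul_left hp).mono hball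
    have hfp : ∀ z ∈ Metric.ball (T y₁) (r / 2), p z * (χ z : ℂ) = p z := fun z hz => by
      simp [hχ1 z (Metric.ball_subset_closedBall hz)]
    have hfL : ∀ z ∈ Metric.ball (T y₁) (r / 2),
        Laplacian.laplacian (fun z => p z * (χ z : ℂ)) z = Laplacian.laplacian p z := fun z hz =>
      (laplacian_congr_nhds (by
        filter_upwards [Metric.isOpen_ball.mem_nhds hz] with x hx using hfp x hx)).eq_of_nhds
    have hy₁' : T y₁ ∈ Metric.ball (T y₁) (r / 2) := Metric.mem_ball_self (half_pos hr)
    refine ⟨connectedComponentIn W y₀ ∩ T ⁻¹' Metric.ball (T y₁) (r / 2),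
      hTG.isOpen_inter_preimage hGo Metric.isOpen_ball,
      ⟨hy₁, hy₁'⟩, inter_subset_left, fun φ hφ => ?_⟩
    have hVΩ : connectedComponentIn W y₀ ∩ T ⁻¹' Metric.ball (T y₁) (r / 2) ⊆ Ω₂ :=
      fun y hy => (hGW hy.1).1
    have h1 := Hlap _ hf φ (hφ.mono hVΩ)
    rw [setIntegral_eq_of_test hVΩ fun x hx => hφ.laplacian_eq_zero hx,
      setIntegral_eq_of_test hVΩ fun x hx => hφ.eq_zero hx] at h1
    refine Eq.trans ?_ (h1.trans ?_)
    · refine integral_congr_ae (ae_of_all _ fun y => ?_)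
      by_cases hy : y ∈ connectedComponentIn W y₀ ∩ T ⁻¹' Metric.ball (T y₁) (r / 2)
      · simp only [hfp _ hy.2]
      · simp only [hφ.laplacian_eq_zero hy, mul_zero]
    · refine integral_congr_ae (ae_of_all _ fun y => ?_)
      by_cases hy : y ∈ connectedComponentIn W y₀ ∩ T ⁻¹' Metric.ball (T y₁) (r / 2)
      · simp only [hfL _ hy.2]
      · simp only [hφ.eq_zero hy, mul_zero]
  have hfull : ∀ y₀ ∈ W, ∀ (A : Eucl d ≃ᵃⁱ[ℝ] Eucl d) (c : ℂ), c ≠ 0 →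
      (∀ y ∈ connectedComponentIn W y₀, T y = A y ∧ h y = c) →
      A ⁻¹' Ω₁ = connectedComponentIn W y₀ := by
    intro y₀ hy₀ A c hc hA
    have hGW := connectedComponentIn_subset W y₀
    have hGo : IsOpen (connectedComponentIn W y₀) := hWo.connectedComponentIn
    have hGA : connectedComponentIn W y₀ ⊆ A ⁻¹' Ω₁ := fun y hy => by
      rw [mem_preimage, ← (hA y hy).1]; exact (hGW hy).2.2
    refine subset_antisymm ?_ hGA
    have hpre : IsPreconnected (A ⁻¹' Ω₁) :=
      (Homeomorph.isPreconnected_preimage A.toHomeomorph).2 hΩ₁.isConnected.isPreconnected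
    -- The component is open, so by connectedness of `A ⁻¹' Ω₁` it suffices that it be relatively
    -- closed there. A limit point in `Ω₂` lies in `W`, hence in the same component; a limit point
    -- on `∂Ω₂` must be excluded.
    refine hpre.subset_of_closure_inter_subset hGo
      ⟨y₀, hGA (mem_connectedComponentIn hy₀), mem_connectedComponentIn hy₀⟩ fun x hx => ?_
    obtain ⟨hxT, hxh⟩ := hext _ A c (hGW.trans hWΩ) hc hA x hx.1
    have hxc : x ∈ closure Ω₂ := closure_mono (hGW.trans hWΩ) hx.1
    have hxT' : T x ∈ Ω₁ := hxT ▸ hx.2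
    by_cases hxΩ : x ∈ Ω₂
    · have hxW : x ∈ W := ⟨hxΩ, hxh ▸ hc, hxT'⟩
      obtain ⟨z, hz1, hz2⟩ := mem_closure_iff_nhds.1 hx.1 _
        ((hWo.connectedComponentIn (x := x)).mem_nhds (mem_connectedComponentIn hxW))
      have e1 := connectedComponentIn_eq hz1
      have e2 := connectedComponentIn_eq hz2
      rw [e2, ← e1]
      exact mem_connectedComponentIn hxW
    exfalso
    have hxf : x ∈ frontier Ω₂ := by rw [hΩ₂.isOpen.frontier_eq]; exact ⟨hxc, hxΩ⟩
    obtain ⟨N, hN, hNW⟩ := mem_nhdsWithin_iff_exists_mem_nhds_inter.1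
      (hWnear x hxc (hxh ▸ hc) hxT')
    obtain ⟨N', hN', hN'N, hconn⟩ := hΩ₂.lipschitz.exists_preconnected hΩ₂.isOpen hxf hN
    -- Near `x` all of `Ω₂` belongs to `W`, and local connectedness at the Lipschitz boundary puts
    -- it in one component, so a single `A` and `c` describe `T` and `h` near `x`.
    have hN'G : N' ∩ Ω₂ ⊆ connectedComponentIn W y₀ := by
      intro y hy
      obtain ⟨z, hz1, hz2⟩ := mem_closure_iff_nhds.1 hx.1 _ hN'
      obtain ⟨P, hP, hzP, hyP, hPN⟩ := hconn z ⟨hz1, (hGW hz2).1⟩ y hy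
      have hPW : P ⊆ W := fun p hp =>
        have h1 := hNW ⟨(hPN hp).1, subset_closure (hPN hp).2⟩
        ⟨(hPN hp).2, h1.1, h1.2⟩
      rw [connectedComponentIn_eq hz2]
      exact hP.subset_connectedComponentIn hzP hPW hyP
    obtain ⟨r, hr, hball⟩ := Metric.mem_nhds_iff.1
      (inter_mem hN' ((hΩ₁.isOpen.preimage A.continuous).mem_nhds hx.2))
    refine not_forall_robin hd1 hΩ₂ hxf hr (β := β) hc fun g hg => ?_
    have hsymm : tsupport (fun z => g (A.symm z)) ⊆ A.symm ⁻¹' tsupport g := by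
      refine closure_minimal (fun z hz => subset_tsupport g hz)
        ((isClosed_tsupport g).preimage A.symm.continuous)
    have hsm : ContDiff ℝ ∞ A.symm := by
      have h1 : (A.symm : Eucl d → Eucl d) = fun z => A.symm 0 + A.symm.linearIsometryEquiv z := by
        funext z
        rw [← AffineIsometryEquiv.map_add_vec, zero_add]
      rw [h1]
      exact contDiff_const.add A.symm.linearIsometryEquiv.contDiff
    -- Any `g` supported near `x` is transported into `Ω₁`, and its image under the weighted
    -- composition is `c * g` near `x`; this supplies the hypothesis of `not_forall_robin`.
    have hft : IsTestFunction Ω₁ fun z => g (A.symm z) := by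
      refine ⟨hg.smooth.comp hsm, ?_, fun z hz => ?_⟩
      · exact hg.compact.comp_homeomorph A.symm.toHomeomorph
      · have := (hball (hg.support (hsymm hz))).2
        simpa using this
    obtain ⟨u, hu, huy⟩ := Hrob _ hft
    refine ⟨u, hu, fun y hy => ?_⟩
    have hyG : y ∈ closure (connectedComponentIn W y₀) := by
      refine closure_mono hN'G (mem_closure_iff_nhds.2 fun M hM => ?_)
      obtain ⟨z, hz1, hz2⟩ := mem_closure_iff_nhds.1 hy.2 _
        (inter_mem hM (Metric.isOpen_ball.mem_nhds hy.1))
      exact ⟨z, hz1.1, (hball hz1.2).1, hz2⟩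
    obtain ⟨e1, e2⟩ := hext _ A c (hGW.trans hWΩ) hc hA y hyG
    rw [huy y hy.2, e1, e2]
    simp
  choose! A c hc hA using hcomp
  let ι := {C : Set (Eucl d) // ∃ y ∈ W, connectedComponentIn W y = C}
  choose y hyW hyC using fun C : ι => C.2
  have hS : ∀ i : ι, A (y i) ⁻¹' Ω₁ = i.1 := fun i => by
    rw [hfull (y i) (hyW i) (A (y i)) (c (y i)) (hc _ (hyW i)) (hA _ (hyW i)), hyC i]
  have hSW : ∀ i : ι, i.1 ⊆ W := fun i => by
    rw [← hyC i]; exact connectedComponentIn_subset _ _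
  have hdisj : ∀ i j : ι, i ≠ j → Disjoint i.1 j.1 := by
    intro i j hij
    rw [disjoint_left]
    intro z hzi hzj
    rw [← hyC i] at hzi
    rw [← hyC j] at hzj
    exact hij (Subtype.ext (by
      rw [← hyC i, ← hyC j, connectedComponentIn_eq hzi, connectedComponentIn_eq hzj]))
  have hopen : ∀ i : ι, IsOpen i.1 := fun i => by
    rw [← hyC i]; exact hWo.connectedComponentIn
  -- Each tile contains a ball of one fixed radius, the tiles are disjoint, and `Ω₂` has finite
  -- volume.
  have hfinite : Finite ι := by
    obtain ⟨z, hz⟩ := hΩ₁.isConnected.nonempty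
    obtain ⟨r, hr, hball⟩ := Metric.isOpen_iff.1 hΩ₁.isOpen z hz
    have hε : 0 < volume (Metric.ball (0 : Eucl d) r) := Metric.measure_ball_pos _ _ hr
    have hle : ∀ i : ι, volume (Metric.ball (0 : Eucl d) r) ≤ volume i.1 := by
      intro i
      rw [← Measure.addHaar_ball_center volume ((A (y i)).symm z) r, ← hS i]
      refine measure_mono fun x hx => hball ?_
      rw [Metric.mem_ball] at hx ⊢
      rwa [← (A (y i)).dist_map, AffineIsometryEquiv.apply_symm_apply] at hx
    have h1 := Measure.finite_const_le_meas_of_disjoint_iUnion volume hε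
      (fun i : ι => (hopen i).measurableSet) (fun i j hij => hdisj i j hij)
      (ne_top_of_le_ne_top hΩ₂.isBounded.measure_lt_top.ne
        (measure_mono (iUnion_subset fun i => (hSW i).trans hWΩ)))
    rw [show {i : ι | volume (Metric.ball (0 : Eucl d) r) ≤ volume i.1} = univ from
      eq_univ_of_forall hle] at h1
    exact finite_univ_iff.1 h1
  have hne : W.Nonempty := by
    obtain ⟨z, hz⟩ := hΩ₂.isConnected.nonempty
    exact closure_nonempty_iff.1 ⟨z, hdense hz⟩
  obtain ⟨y₀, hy₀⟩ := hne
  let i₀ : ι := ⟨_, y₀, hy₀, rfl⟩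
  have hval : ∀ i : ι, ∀ q ∈ closure i.1, T q = A (y i) q ∧ h q = c (y i) := by
    intro i
    refine hext i.1 (A (y i)) (c (y i)) ((hSW i).trans hWΩ) (hc _ (hyW i)) ?_
    rw [← hyC i]
    exact hA _ (hyW i)
  have htile := eq_of_tiling hd hΩ₁ hΩ₂ hC1 (fun i : ι => A (y i))
    (fun i j hij => by rw [hS, hS]; exact hdisj i j hij)
    (fun i => by rw [hS]; exact (hSW i).trans hWΩ)
    (by
      refine hdense.trans (closure_mono fun z hz => mem_iUnion.2 ?_)
      exact ⟨⟨_, z, hz, rfl⟩, by rw [hS]; exact mem_connectedComponentIn hz⟩)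
    (fun i j q hq => by
      rw [hS, hS] at hq
      rw [← (hval i q hq.2.1).1, (hval j q hq.2.2).1]) i₀
  refine ⟨A (y i₀), c (y i₀), hc _ (hyW i₀), htile, ?_⟩
  rw [← htile, hS]
  exact hval i₀

/-! ### Representing the operator and concluding -/

theorem zeroExt_apply {S : Set (Eucl d)} (u : C(S, ℂ)) {y : Eucl d} (hy : y ∈ S) :
    zeroExt u y = u ⟨y, hy⟩ :=
  Subtype.val_injective.extend_apply u 0 ⟨y, hy⟩

theorem continuousOn_zeroExt {S : Set (Eucl d)} (u : C(S, ℂ)) : ContinuousOn (zeroExt u) S := by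
  rw [continuousOn_iff_continuous_domRestrict]
  exact u.continuous.congr fun y => (zeroExt_apply u y.2).symm

end RobinIntertwining

open RobinIntertwining
theorem mainTheorem9 (d : ℕ) (hd : 2 ≤ d) (Ω₁ Ω₂ : Set (Eucl d))
    (hΩ₁ : IsLipschitzDomain Ω₁) (hΩ₂ : IsLipschitzDomain Ω₂) (hC1 : HasC1Boundary Ω₁)
    (U : C(closure Ω₁, ℂ) →L[ℂ] C(closure Ω₂, ℂ))
    (ha : DisjointnessPreserving U)
    (hb : ∃ β : C(frontier Ω₂, ℂ), IntertwinesOnTestFunctions β U)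
    (hc : NonDegenerate U) :
    ∃ (τ : Eucl d ≃ᵢ Eucl d) (c : ℂ) (hτ : Set.MapsTo τ (closure Ω₂) (closure Ω₁)),
      τ '' Ω₂ = Ω₁ ∧ c ≠ 0 ∧
      ∀ (f : C(closure Ω₁, ℂ)) (y : closure Ω₂), U f y = c * f ⟨τ y, hτ y.2⟩ := by
  obtain ⟨β, hβ⟩ := hb
  have : CompactSpace (closure Ω₁) := isCompact_iff_compactSpace.1 hΩ₁.isBounded.isCompact_closure
  have : Nonempty (closure Ω₁) := hΩ₁.isConnected.nonempty.closure.to_subtype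
  have hrep : ∀ y : closure Ω₂, ∃ x : closure Ω₁, ∀ f, U f y = U 1 y * f x := fun y =>
    exists_eq_mul_eval ((ContinuousMap.evalCLM ℂ y).comp U) fun f g hfg => by
      have := congrArg (fun w : C(closure Ω₂, ℂ) => w y) (ha f g hfg)
      simpa using this
  choose τ₀ hτ₀ using hrep
  classical
  set T : Eucl d → Eucl d := fun y => if hy : y ∈ closure Ω₂ then τ₀ ⟨y, hy⟩ else 0 with hTdef
  have hT : ∀ y : closure Ω₂, T y = τ₀ y := fun y => by simp [hTdef]
  have hzU : ∀ (f : Eucl d → ℂ) (hf : Continuous f), ∀ y ∈ closure Ω₂,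
      zeroExt (U (restr (closure Ω₁) f hf)) y = zeroExt (U 1) y * f (T y) := by
    intro f hf y hy
    rw [zeroExt_apply _ hy, zeroExt_apply _ hy, hτ₀, show T y = τ₀ ⟨y, hy⟩ from hT ⟨y, hy⟩]
    rfl
  have hcont : ContinuousOn T (closure Ω₂ ∩ {y | zeroExt (U 1) y ≠ 0}) := by
    -- The coordinates of `T` are the quotients `U x_i / U 1` of continuous functions.
    have hi : ∀ i, ContinuousOn (fun y => T y i) (closure Ω₂ ∩ {y | zeroExt (U 1) y ≠ 0}) := by
      intro i
      have h1 : ContinuousOn (fun y => ((zeroExt (U 1) y)⁻¹ *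
          zeroExt (U (restr (closure Ω₁) _ (contDiff_coord i).continuous)) y).re)
          (closure Ω₂ ∩ {y | zeroExt (U 1) y ≠ 0}) :=
        Complex.continuous_re.comp_continuousOn
          ((((continuousOn_zeroExt _).mono inter_subset_left).inv₀ fun y hy => hy.2).mul
            ((continuousOn_zeroExt _).mono inter_subset_left))
      refine h1.congr fun y hy => ?_
      simp only [hzU _ (contDiff_coord i).continuous y hy.1, inv_mul_cancel_left₀ hy.2,
        Complex.ofReal_re]
    have h2 := (PiLp.continuous_toLp 2 (fun _ : Fin d => ℝ)).comp_continuousOn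
      (continuousOn_pi.2 hi)
    exact h2
  obtain ⟨A, c, hc0, htile, hA⟩ := exists_congruence hd hΩ₁ hΩ₂ hC1 (h := zeroExt (U 1)) (T := T)
    (β := zeroExt β) (continuousOn_zeroExt _) hcont
    (fun f hf φ hφ => by
      refine (setIntegral_congr_fun hΩ₂.isOpen.measurableSet fun y hy => ?_).trans
        (((hβ f hf).2 φ hφ).trans
          (setIntegral_congr_fun hΩ₂.isOpen.measurableSet fun y hy => ?_))
      · simp only [hzU f hf.smooth.continuous y (subset_closure hy)]
      · simp only [hzU _ (continuous_laplacian hf.smooth) y (subset_closure hy)])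
    (fun f hf => ⟨_, (hβ f hf).1.2.2, hzU f hf.smooth.continuous⟩)
    (fun W hW hWΩ hf0 => hc W hW hWΩ fun f hf y hy => by
      have h1 := hzU f hf.smooth.continuous y y.2
      rw [zeroExt_apply _ y.2, hf0 f hf y hy] at h1
      exact h1)
  have hmaps : MapsTo A.toIsometryEquiv (closure Ω₂) (closure Ω₁) := by
    intro y hy
    change A y ∈ closure Ω₁
    rw [← (hA y hy).1, show T y = τ₀ ⟨y, hy⟩ from hT ⟨y, hy⟩]
    exact (τ₀ _).2
  refine ⟨A.toIsometryEquiv, c, hmaps, ?_, hc0, fun f y => ?_⟩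
  · rw [← htile]
    exact image_preimage_eq _ A.surjective
  · obtain ⟨h1, h2⟩ := hA y y.2
    rw [zeroExt_apply _ y.2] at h2
    rw [hτ₀, h2]
    congr 2
    exact Subtype.ext (by rw [← hT y, h1]; rfl)
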